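/- Let $P\subset\mathbb R^N$ be a convex polytope (the convex hull of a finite set). A linear functional $\varphi$ is admissible for $P$ if it is not constant on any edge of $P$; it then orients the graph of $P$, each edge being directed in the direction of increase of $\varphi$. A sink is a vertex of $P$ with no outgoing edge in this orientation. A monotone path is a directed path in the oriented graph, and its length is its number of edges. Let $\Delta_m(d,n)$ be the supremum, over all $d$-dimensional polytopes $P$ with exactly $n$ facets, all functionals $\varphi$ admissible for $P$, and all vertices $v$ of $P$, of the length of a shortest monotone path from $v$ to the sink (taken to be $\infty$ if there is no such path). Then $$\Delta_m(5,10)\le 7.$$ -/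

import Mathlib

namespace MonotoneDiameter

variable {E : Type*} [AddCommGroup E] [Module ℝ E]

/-- A convex polytope: the convex hull of a finite set of points. -/
def IsPolytope (P : Set E) : Prop :=
  ∃ s : Finset E, P = convexHull ℝ (s : Set E)

/-- The dimension of the affine hull of a (nonempty) set. -/
noncomputable def dim (P : Set E) : ℕ :=
  Module.finrank ℝ (vectorSpan ℝ P)

variable [TopologicalSpace E]

/-- A nonempty face of `P`: the set of points of `P` at which some linear functional attains
its maximum over `P` (the zero functional gives `P` itself). -/
def IsFace (P F : Set E) : Prop :=
  F.Nonempty ∧ IsExposed ℝ P F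

/-- A facet: a face of codimension one. -/
def IsFacet (P F : Set E) : Prop :=
  IsFace P F ∧ dim F + 1 = dim P

/-- An edge: a face of dimension one. -/
def IsEdge (P e : Set E) : Prop :=
  IsFace P e ∧ dim e = 1

/-- `φ` is admissible for `P` if it is not constant on any edge of `P`. -/
def Admissible (P : Set E) (φ : E →ₗ[ℝ] ℝ) : Prop :=
  ∀ e, IsEdge P e → ∃ x ∈ e, ∃ y ∈ e, φ x ≠ φ y

/-- There is an edge of `P` with end points `u` and `v`, directed from `u` to `v`
(the direction in which `φ` increases). -/
def Arc (P : Set E) (φ : E →ₗ[ℝ] ℝ) (u v : E) : Prop :=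
  IsEdge P (segment ℝ u v) ∧ φ u < φ v

/-- A sink of the directed graph of `P`: a vertex with no outgoing arc. -/
def IsSink (P : Set E) (φ : E →ₗ[ℝ] ℝ) (w : E) : Prop :=
  w ∈ P.extremePoints ℝ ∧ ∀ u, ¬ Arc P φ w u

/-- There is a directed path (monotone path) with `k` arcs from `v` to `w`. -/
def HasMonotonePath (P : Set E) (φ : E →ₗ[ℝ] ℝ) (v w : E) (k : ℕ) : Prop :=
  ∃ p : Fin (k + 1) → E, p 0 = v ∧ p (Fin.last k) = w ∧
    ∀ i : Fin k, Arc P φ (p i.castSucc) (p i.succ)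

/-- The length of a shortest monotone path from `v` to `w` (`⊤` if there is none). -/
noncomputable def monotoneDist (P : Set E) (φ : E →ₗ[ℝ] ℝ) (v w : E) : ℕ∞ :=
  sInf {k : ℕ∞ | ∃ j : ℕ, k = j ∧ HasMonotonePath P φ v w j}

/-- `Δ_m(d, n)`: the supremum of the lengths of shortest monotone paths from a vertex `v` to the
sink `w`, over all `d`-dimensional polytopes `P` (in any `ℝ^N`) with exactly `n` facets, all
admissible functionals `φ` for `P`, and all vertices `v` of `P`. -/
noncomputable def monotoneDiameter (d n : ℕ) : ℕ∞ :=
  sSup {k : ℕ∞ | ∃ (N : ℕ) (P : Set (Fin N → ℝ)) (φ : (Fin N → ℝ) →ₗ[ℝ] ℝ) (v w : Fin N → ℝ),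
    IsPolytope P ∧ dim P = d ∧ {F | IsFacet P F}.encard = n ∧ Admissible P φ ∧
    v ∈ P.extremePoints ℝ ∧ IsSink P φ w ∧ k = monotoneDist P φ v w}

end MonotoneDiameter

/-! ### Simple polytopes as vertex-facet incidences. -/

namespace MonotoneDiameter

open Finset

/-! For a simple polytope the bound is 2 + 5. Two monotone steps from any vertex reach a vertex
sharing at least two facets with the top (`exists_two_steps`). This rests on 10 = 2 * 5: there are
as many facets missing both `v` and the top as facets containing both. Two shared facets cut out a
3-face containing the top, and at most 8 other facets meet it. The monotone Hirsch bound in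
dimension three (`exists_walk_three`) then gives at most 8 - 3 = 5 further steps.

In dimension three, a potential pays for the steps: the number of facets having a vertex not below
the current one. A vertex with a single upper neighbour is the maximum of a facet, and this facet is
lost once that vertex is passed. Look at the directed distance levels from `x` up to the first
singleton level, or up to the top. Earlier levels have at least two vertices, and a degree count,
sharpened by 3-edge-connectivity of the graph, shows that at least as many facets are lost as steps
are made (`exists_bottleneck_walk`).

A general polytope is the solution set of its ten facet inequalities within its affine span
(`exists_facet_separating`). Slightly increasing the right-hand sides makes the system simple
(`exists_isSimple`). Solving the same equalities with the old right-hand sides sends the new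
vertices onto the old ones, collapsing some edges and sending the others to edges with compatible
orientation. Monotone paths therefore project to monotone paths that are no longer
(`exists_walk_edgeUp`). -/

/-- The vertex-facet incidences of a simple polytope of dimension `d`, with vertices linearly
ordered so that a vertex which is a local maximum on a face is the maximum of that face. -/
structure SimpleSystem {ι V : Type*} [DecidableEq ι] [LinearOrder V] (d : ℕ)
    (facets : V → Finset ι) : Prop where
  card : ∀ v, (facets v).card = d
  inj : Function.Injective facets
  nbr : ∀ v, ∀ i ∈ facets v, ∃! u, u ≠ v ∧ (facets v).erase i ⊆ facets u
  opt : ∀ (K : Finset ι) (v : V), K ⊆ facets v →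
    (∀ u, u ≠ v → K ⊆ facets u → ∀ i ∈ facets v, (facets v).erase i ⊆ facets u → u < v) →
    ∀ u, K ⊆ facets u → u ≤ v

/-- There is an edge from the lower vertex `u` to the higher vertex `v`. -/
def Up {ι V : Type*} [DecidableEq ι] [LinearOrder V] (facets : V → Finset ι) (u v : V) : Prop :=
  u < v ∧ ∃ i ∈ facets u, (facets u).erase i ⊆ facets v

/-- A directed walk with `k` steps. -/
def Walk {V : Type*} (R : V → V → Prop) : ℕ → V → V → Prop
  | 0, u, v => u = v
  | k + 1, u, v => ∃ y, Walk R k u y ∧ R y v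

theorem Walk.trans {V : Type*} {R : V → V → Prop} {j k : ℕ} {u v w : V} (h : Walk R j u v)
    (h' : Walk R k v w) : Walk R (j + k) u w := by
  induction k generalizing w with
  | zero => cases h'; exact h
  | succ k ih => obtain ⟨y, hy, hr⟩ := h'; exact ⟨y, ih hy, hr⟩

theorem Walk.single {V : Type*} {R : V → V → Prop} {u v : V} (h : R u v) : Walk R 1 u v :=
  ⟨u, rfl, h⟩

namespace SimpleSystem

variable {ι V : Type*} [DecidableEq ι] [LinearOrder V] {d : ℕ} {facets : V → Finset ι}

theorem eq_of_subset (h : SimpleSystem d facets) {u v : V} (huv : facets u ⊆ facets v) : u = v :=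
  h.inj (eq_of_subset_of_card_le huv (by rw [h.card, h.card]))

theorem notMem_of_erase_subset (h : SimpleSystem d facets) {u v : V} {i : ι} (hne : v ≠ u)
    (hs : (facets u).erase i ⊆ facets v) : i ∉ facets v := by
  intro hi
  refine hne (h.eq_of_subset fun j hj => ?_).symm
  by_cases hji : j = i
  · rwa [hji]
  · exact hs (mem_erase.2 ⟨hji, hj⟩)

/-- Adjacency is symmetric. -/
theorem adj_symm (h : SimpleSystem d facets) {u v : V} (hne : v ≠ u)
    (hs : ∃ i ∈ facets u, (facets u).erase i ⊆ facets v) :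
    ∃ i ∈ facets v, (facets v).erase i ⊆ facets u := by
  obtain ⟨i, hi, hs⟩ := hs
  have hiv := h.notMem_of_erase_subset hne hs
  have hcard : (facets v \ (facets u).erase i).card = 1 := by
    rw [card_sdiff_of_subset hs, card_erase_of_mem hi, h.card, h.card]
    have := card_pos.2 ⟨i, hi⟩
    rw [h.card] at this
    omega
  obtain ⟨j, hj⟩ := card_eq_one.1 hcard
  have hjm : j ∈ facets v \ (facets u).erase i := by rw [hj]; simp
  refine ⟨j, (mem_sdiff.1 hjm).1, fun k hk => ?_⟩
  by_contra hku
  have : k ∈ facets v \ (facets u).erase i :=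
    mem_sdiff.2 ⟨mem_of_mem_erase hk, fun h' => hku (mem_of_mem_erase h')⟩
  rw [hj, mem_singleton] at this
  exact (mem_erase.1 hk).1 this

/-- A vertex which is not the maximum of a face containing it has a higher neighbour there. -/
theorem exists_up (h : SimpleSystem d facets) {K : Finset ι} {v w : V} (hv : K ⊆ facets v)
    (hw : K ⊆ facets w) (hvw : v < w) : ∃ u, Up facets v u ∧ K ⊆ facets u := by
  by_contra! hcon
  refine absurd (h.opt K v hv (fun u hne hu i hi hs => ?_) w hw) (not_le.2 hvw)
  rcases lt_or_gt_of_ne hne with h1 | h1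
  · exact h1
  · exact absurd hu (hcon u ⟨h1, i, hi, hs⟩)

/-- The system induced on a face. -/
theorem link (h : SimpleSystem d facets) (K : Finset ι) {e : ℕ} (he : K.card + e = d) :
    SimpleSystem e (fun v : {v : V // K ⊆ facets v} => facets v \ K) where
  card v := by
    rw [card_sdiff_of_subset v.2, h.card]
    omega
  inj u v huv := by
    refine Subtype.ext (h.inj ?_)
    have h1 := congrArg (· ∪ K) huv
    simpa [sdiff_union_of_subset u.2, sdiff_union_of_subset v.2] using h1
  nbr v i hi := by
    rw [mem_sdiff] at hi
    obtain ⟨u, ⟨hne, hs⟩, huniq⟩ := h.nbr v i hi.1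
    have key : ∀ u' : V, K ⊆ facets u' → ((facets v \ K).erase i ⊆ facets u' \ K) →
        (facets v).erase i ⊆ facets u' := by
      intro u' hu' hs' k hk
      by_cases hkK : k ∈ K
      · exact hu' hkK
      · exact (mem_sdiff.1 (hs' (mem_erase.2 ⟨(mem_erase.1 hk).1,
          mem_sdiff.2 ⟨(mem_erase.1 hk).2, hkK⟩⟩))).1
    have hKu : K ⊆ facets u := fun k hk =>
      hs (mem_erase.2 ⟨fun h' => hi.2 (h' ▸ hk), v.2 hk⟩)
    refine ⟨⟨u, hKu⟩, ⟨fun h' => hne (congrArg Subtype.val h'), fun k hk => ?_⟩, ?_⟩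
    · rw [mem_erase, mem_sdiff] at hk
      exact mem_sdiff.2 ⟨hs (mem_erase.2 ⟨hk.1, hk.2.1⟩), hk.2.2⟩
    · rintro ⟨u', hu'⟩ ⟨hne', hs'⟩
      refine Subtype.ext (huniq u' ⟨fun h' => hne' (Subtype.ext h'), key u' hu' hs'⟩)
  opt J v hJ hloc u hu := by
    refine h.opt (J ∪ K) v ?_ (fun u' hne hu' i hi hs => ?_) u ?_
    · exact union_subset (hJ.trans sdiff_subset) v.2
    · have hKu' : K ⊆ facets u' := subset_union_right.trans hu'
      have hiK : i ∉ K := fun hiK => h.notMem_of_erase_subset hne hs (hKu' hiK)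
      refine hloc ⟨u', hKu'⟩ (fun h' => hne (congrArg Subtype.val h')) (fun k hk => ?_) i
        (mem_sdiff.2 ⟨hi, hiK⟩) (fun k hk => ?_)
      · exact mem_sdiff.2 ⟨hu' (mem_union_left _ hk), (mem_sdiff.1 (hJ hk)).2⟩
      · rw [mem_erase, mem_sdiff] at hk
        exact mem_sdiff.2 ⟨hs (mem_erase.2 ⟨hk.1, hk.2.1⟩), hk.2.2⟩
    · exact union_subset (hu.trans sdiff_subset) u.2

theorem up_of_link {K : Finset ι} {u v : {v : V // K ⊆ facets v}}
    (huv : Up (fun v : {v : V // K ⊆ facets v} => facets v \ K) u v) :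
    Up facets u.1 v.1 := by
  obtain ⟨hlt, i, hi, hs⟩ := huv
  refine ⟨hlt, i, (mem_sdiff.1 hi).1, fun k hk => ?_⟩
  by_cases hkK : k ∈ K
  · exact v.2 hkK
  · exact (mem_sdiff.1 (hs (mem_erase.2 ⟨(mem_erase.1 hk).1,
      mem_sdiff.2 ⟨(mem_erase.1 hk).2, hkK⟩⟩))).1

theorem walk_of_link {K : Finset ι} {k : ℕ} {u v : {v : V // K ⊆ facets v}}
    (huv : Walk (Up (fun v : {v : V // K ⊆ facets v} => facets v \ K)) k u v) :
    Walk (Up facets) k u.1 v.1 := by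
  induction k generalizing v with
  | zero => exact congrArg Subtype.val huv
  | succ k ih => obtain ⟨y, hy, hr⟩ := huv; exact ⟨y.1, ih hy, up_of_link hr⟩

/-! ### Two steps to a vertex sharing two facets with the top. -/

/-- In dimension five with ten facets, two steps lead from any vertex to one that
shares two facets with the top. -/
theorem exists_two_steps [Fintype ι] [Finite V] (h : SimpleSystem 5 facets)
    (hι : Fintype.card ι = 10) {v w : V} (hw : ∀ u, u ≤ w) :
    ∃ y k, k ≤ 2 ∧ Walk (Up facets) k v y ∧ 2 ≤ (facets y ∩ facets w).card := by
  classical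
  by_cases h2 : 2 ≤ (facets v ∩ facets w).card
  · exact ⟨v, 0, by simp, rfl, h2⟩
  have hne : ∀ x, ¬ 2 ≤ (facets x ∩ facets w).card → x < w := by
    intro x hx
    refine lt_of_le_of_ne (hw x) ?_
    rintro rfl
    rw [inter_self, h.card] at hx
    omega
  -- the highest upper neighbour of `v` on the face spanned by `v` and `w`
  set C := facets v ∩ facets w with hC
  obtain ⟨u₀, hu₀⟩ := h.exists_up (K := C) inter_subset_left inter_subset_right (hne v h2)
  obtain ⟨u, ⟨⟨hvu, i, hi, hs⟩, hCu⟩, hmax⟩ := Set.exists_max_image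
    {u | Up facets v u ∧ C ⊆ facets u} id (Set.toFinite _) ⟨u₀, hu₀⟩
  have hup : Up facets v u := ⟨hvu, i, hi, hs⟩
  by_cases h2u : 2 ≤ (facets u ∩ facets w).card
  · exact ⟨u, 1, by simp, Walk.single hup, h2u⟩
  obtain ⟨y, ⟨huy, k, hk, hsy⟩, hy⟩ := h.exists_up (K := facets u ∩ facets w)
    inter_subset_left inter_subset_right (hne u h2u)
  refine ⟨y, 2, le_rfl, (Walk.single hup).trans (Walk.single ⟨huy, k, hk, hsy⟩), ?_⟩
  have hiu := h.notMem_of_erase_subset hvu.ne' hs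
  have hky := h.notMem_of_erase_subset huy.ne' hsy
  have hkw : k ∉ facets w := fun hkw => hky (hy (mem_inter.2 ⟨hk, hkw⟩))
  have hiw : i ∉ facets w := fun hiw => hiu (hCu (mem_inter.2 ⟨hi, hiw⟩))
  by_contra hlt
  -- the new facet `g` of `u` and the new facet `j` of `y`
  obtain ⟨g, hg, hgu⟩ : ∃ g ∈ facets u, g ∉ facets v := by
    by_contra! hcon
    exact hvu.ne' (h.eq_of_subset hcon)
  obtain ⟨j, hj, hju⟩ : ∃ j ∈ facets y, j ∉ facets u := by
    by_contra! hcon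
    exact huy.ne' (h.eq_of_subset hcon)
  have hueq : facets u = insert g ((facets v).erase i) := by
    refine (eq_of_subset_of_card_le (insert_subset hg hs) ?_).symm
    rw [card_insert_of_notMem (by simp [hgu]), card_erase_of_mem hi, h.card, h.card]
  have hyeq : facets y = insert j ((facets u).erase k) := by
    refine (eq_of_subset_of_card_le (insert_subset hj hsy) ?_).symm
    rw [card_insert_of_notMem (by simp [hju]), card_erase_of_mem hk, h.card, h.card]
  -- If the second step left the facet just entered, `y` would lie, like `u`, on the edge of `v`
  -- that leaves `i`; that edge has only one other end.
  have hgk : g ≠ k := by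
    rintro rfl
    obtain ⟨x, -, hx⟩ := h.nbr v i hi
    have h1 : (facets v).erase i ⊆ facets y := by
      rw [hyeq, hueq, erase_insert (by simp [hgu])]
      exact subset_insert _ _
    have h3 := hx y ⟨(hvu.trans huy).ne', h1⟩
    have h4 := hx u ⟨hvu.ne', hs⟩
    exact huy.ne (h4.trans h3.symm)
  have hkv : k ∈ facets v := by
    rw [hueq, mem_insert] at hk
    exact mem_of_mem_erase (hk.resolve_left hgk.symm)
  -- If the second step returned to `i`, then `y` would be a neighbour of `v` on the face `C`,
  -- higher than `u`, against the choice of `u`.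
  have hji : j ≠ i := by
    rintro rfl
    have h1 : (facets v).erase k ⊆ facets y := by
      intro m hm
      rw [hyeq, hueq]
      have := mem_erase.1 hm
      by_cases hmj : m = j
      · simp [hmj]
      · simp [hmj, this]
    have hCy : C ⊆ facets y := fun m hm => h1 (mem_erase.2
      ⟨fun hmk => hkw (hmk ▸ (mem_inter.1 hm).2), (mem_inter.1 hm).1⟩)
    exact absurd (hmax y ⟨⟨hvu.trans huy, k, hkv, h1⟩, hCy⟩) (not_le.2 huy)
  have hjv : j ∉ facets v := fun hjv => hju (hs (mem_erase.2 ⟨hji, hjv⟩))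
  have hgj : g ≠ j := fun h' => hju (h' ▸ hg)
  have hgy : g ∈ facets y := hsy (mem_erase.2 ⟨hgk, hg⟩)
  -- `g`, `j` lie outside `v`
  have hsub : C ⊆ facets y ∩ facets w := fun m hm => mem_inter.2
    ⟨hsy (mem_erase.2 ⟨fun hmk => hkw (hmk ▸ (mem_inter.1 hm).2), hCu hm⟩), (mem_inter.1 hm).2⟩
  -- Since 10 = 5 + 5, exactly `C.card` facets avoid both `v` and `w`. As `g` and `j` are distinct
  -- and not in `v`, at least `2 - C.card` of them belong to `w`. Together with `C`, which `y`
  -- keeps, they give two common facets.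
  have hcount : (facets v ∪ facets w).card + C.card = 10 := by
    rw [hC, card_union_add_card_inter, h.card, h.card]
  have hco : ((facets v ∪ facets w)ᶜ).card = C.card := by
    rw [card_compl, hι]; omega
  have hgjsub : ({g, j} : Finset ι) ⊆ (({g, j} : Finset ι) ∩ facets w) ∪ (facets v ∪ facets w)ᶜ := by
    intro m hm
    by_cases hmw : m ∈ facets w
    · exact mem_union_left _ (mem_inter.2 ⟨hm, hmw⟩)
    · refine mem_union_right _ (mem_compl.2 fun hmm => ?_)
      rcases mem_union.1 hmm with hmv | hmv
      · rcases mem_insert.1 hm with rfl | hm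
        · exact hgu hmv
        · rw [mem_singleton] at hm
          exact hjv (hm ▸ hmv)
      · exact hmw hmv
  have h5 : 2 ≤ (({g, j} : Finset ι) ∩ facets w).card + C.card := by
    calc 2 = ({g, j} : Finset ι).card := (card_pair hgj).symm
      _ ≤ _ := card_le_card hgjsub
      _ ≤ _ := card_union_le _ _
      _ = _ := by rw [hco]
  have hdisj : Disjoint (({g, j} : Finset ι) ∩ facets w) C := by
    rw [disjoint_left]
    intro m hm hmC
    have hmv := (mem_inter.1 hmC).1
    rcases mem_insert.1 (mem_inter.1 hm).1 with rfl | hm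
    · exact hgu hmv
    · rw [mem_singleton] at hm
      exact hjv (hm ▸ hmv)
  have h6 : (({g, j} : Finset ι) ∩ facets w) ∪ C ⊆ facets y ∩ facets w := by
    refine union_subset (fun m hm => mem_inter.2 ⟨?_, (mem_inter.1 hm).2⟩) hsub
    rcases mem_insert.1 (mem_inter.1 hm).1 with rfl | hm
    · exact hgy
    · rw [mem_singleton] at hm
      exact hm ▸ hj
  have h7 := card_le_card h6
  rw [card_union_of_disjoint hdisj] at h7
  omega

end SimpleSystem

end MonotoneDiameter

/-! ### Degrees, and 3-edge-connectivity in dimension three. -/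

namespace MonotoneDiameter

open Finset

namespace SimpleSystem

variable {ι V : Type*} [DecidableEq ι] [LinearOrder V] {d : ℕ} {facets : V → Finset ι}

section Neighbours

variable [Fintype V]

open Classical in
/-- The upper neighbours of a vertex. -/
noncomputable def above (facets : V → Finset ι) (x : V) : Finset V :=
  univ.filter fun u => Up facets x u

open Classical in
/-- The lower neighbours of a vertex. -/
noncomputable def below (facets : V → Finset ι) (x : V) : Finset V :=
  univ.filter fun u => Up facets u x

theorem mem_above {x u : V} : u ∈ above facets x ↔ Up facets x u := by simp [above]

theorem mem_below {x u : V} : u ∈ below facets x ↔ Up facets u x := by simp [below]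

theorem disjoint_above_below (x : V) : Disjoint (above facets x) (below facets x) := by
  rw [disjoint_left]
  intro u h1 h2
  exact lt_asymm (mem_above.1 h1).1 (mem_below.1 h2).1

theorem mem_above_union_below (h : SimpleSystem d facets) {x u : V} :
    u ∈ above facets x ∪ below facets x ↔
      u ≠ x ∧ ∃ i ∈ facets x, (facets x).erase i ⊆ facets u := by
  rw [mem_union, mem_above, mem_below]
  constructor
  · rintro (⟨h1, h2⟩ | ⟨h1, h2⟩)
    · exact ⟨h1.ne', h2⟩
    · exact ⟨h1.ne, h.adj_symm h1.ne' h2⟩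
  · rintro ⟨hne, h2⟩
    rcases lt_or_gt_of_ne hne with h1 | h1
    · exact Or.inr ⟨h1, h.adj_symm hne h2⟩
    · exact Or.inl ⟨h1, h2⟩

theorem mem_above_union_below_comm {x u : V} :
    u ∈ above facets x ∪ below facets x ↔ x ∈ above facets u ∪ below facets u := by
  simp only [mem_union, mem_above, mem_below, or_comm]

theorem card_neighbours (h : SimpleSystem d facets) (x : V) :
    (above facets x ∪ below facets x).card = d := by
  rw [← h.card x]
  symm
  refine card_bij (fun i hi => (h.nbr x i hi).choose) ?_ ?_ ?_
  · intro i hi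
    have := (h.nbr x i hi).choose_spec.1
    exact h.mem_above_union_below.2 ⟨this.1, i, hi, this.2⟩
  · intro i hi j hj hij
    by_contra hne
    have h1 := (h.nbr x i hi).choose_spec.1
    have h2 := (h.nbr x j hj).choose_spec.1
    rw [← hij] at h2
    exact h.notMem_of_erase_subset h1.1 h1.2 (h2.2 (mem_erase.2 ⟨hne, hi⟩))
  · intro u hu
    obtain ⟨hne, i, hi, hs⟩ := h.mem_above_union_below.1 hu
    exact ⟨i, hi, ((h.nbr x i hi).choose_spec.2 u ⟨hne, hs⟩).symm⟩

theorem card_above_add_card_below (h : SimpleSystem d facets) (x : V) :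
    (above facets x).card + (below facets x).card = d := by
  rw [← card_union_of_disjoint (disjoint_above_below x), h.card_neighbours x]

/-- Of the `d + 1` edges at `x`, only the one obtained by dropping `L` leaves the facet `L`. -/
theorem card_neighbours_filter (h : SimpleSystem (d + 1) facets) {x : V} {L : ι}
    (hL : L ∈ facets x) :
    ((above facets x ∪ below facets x).filter (L ∈ facets ·)).card = d := by
  have h1 := card_filter_add_card_filter_not (s := above facets x ∪ below facets x)
    (fun u => L ∈ facets u)
  rw [h.card_neighbours x] at h1
  obtain ⟨u, ⟨hne, hs⟩, huniq⟩ := h.nbr x L hL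
  have h2 : (above facets x ∪ below facets x).filter (L ∉ facets ·) = {u} := by
    ext u'
    rw [mem_filter, h.mem_above_union_below, mem_singleton]
    constructor
    · rintro ⟨⟨hne', i, hi, hs'⟩, hL'⟩
      have : i = L := by
        by_contra hiL
        exact hL' (hs' (mem_erase.2 ⟨Ne.symm hiL, hL⟩))
      exact huniq u' ⟨hne', this ▸ hs'⟩
    · rintro rfl
      exact ⟨⟨hne, L, hL, hs⟩, h.notMem_of_erase_subset hne hs⟩
  rw [h2, card_singleton] at h1
  omega

/-- In dimension three, an even number of edges of a facet leave any set of vertices. -/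
theorem even_card_boundary (h : SimpleSystem 3 facets) (S : Finset V) (L : ι) :
    Even ((univ.filter fun p : V × V => (p.1 ∈ S ∧ p.2 ∉ S) ∧
      p.2 ∈ above facets p.1 ∪ below facets p.1 ∧ L ∈ facets p.1 ∧ L ∈ facets p.2).card) := by
  classical
  set E : Finset (V × V) := univ.filter fun p : V × V =>
      p.2 ∈ above facets p.1 ∪ below facets p.1 ∧ L ∈ facets p.1 ∧ L ∈ facets p.2 with hE
  -- Every vertex of the polygon `L` has two neighbours on it, so the degrees of the vertices in `S`
  -- have an even sum. Edges inside `S` are counted twice there, as `hswap` shows, so the edges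
  -- leaving `S` are even in number.
  have hall : (E.filter (·.1 ∈ S)).card = ∑ s ∈ S.filter (L ∈ facets ·), 2 := by
    rw [card_eq_sum_card_fiberwise (f := Prod.fst) (t := S.filter (L ∈ facets ·))]
    · refine sum_congr rfl fun s hs => ?_
      rw [mem_filter] at hs
      rw [← h.card_neighbours_filter (d := 2) hs.2]
      refine card_bij (fun p _ => p.2) ?_ ?_ ?_
      · rintro ⟨a, b⟩ hp
        simp only [hE, mem_filter, mem_univ, true_and] at hp ⊢
        obtain ⟨⟨⟨h1, h2, h3⟩, h4⟩, rfl⟩ := hp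
        exact ⟨h1, h3⟩
      · rintro ⟨a, b⟩ hp ⟨a', b'⟩ hp' hb
        rw [mem_filter] at hp hp'
        exact Prod.ext (hp.2.trans hp'.2.symm) hb
      · intro b hb
        rw [mem_filter] at hb
        refine ⟨(s, b), ?_, rfl⟩
        simp only [hE, mem_filter, mem_univ, true_and]
        exact ⟨⟨⟨hb.1, hs.2, hb.2⟩, hs.1⟩, trivial⟩
    · rintro ⟨a, b⟩ hp
      simp only [hE, coe_filter, mem_filter, mem_univ, true_and, Set.mem_ofPred_eq] at hp ⊢
      exact ⟨hp.2, hp.1.2.1⟩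
  have hsplit := card_filter_add_card_filter_not (s := E.filter (·.1 ∈ S)) (·.2 ∈ S)
  have hin := card_filter_add_card_filter_not
    (s := (E.filter (·.1 ∈ S)).filter (·.2 ∈ S)) (fun p => p.1 < p.2)
  have hswap : (((E.filter (·.1 ∈ S)).filter (·.2 ∈ S)).filter (fun p => p.1 < p.2)).card =
      (((E.filter (·.1 ∈ S)).filter (·.2 ∈ S)).filter (fun p => ¬ p.1 < p.2)).card := by
    refine card_nbij' Prod.swap Prod.swap ?_ ?_ (fun _ _ => rfl) (fun _ _ => rfl)
    · rintro ⟨a, b⟩ hp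
      simp only [hE, coe_filter, mem_filter, mem_univ, true_and, Set.mem_ofPred_eq, Prod.fst_swap,
        Prod.snd_swap] at hp ⊢
      obtain ⟨⟨⟨⟨h1, h2, h3⟩, h4⟩, h5⟩, h6⟩ := hp
      exact ⟨⟨⟨⟨mem_above_union_below_comm.1 h1, h3, h2⟩, h5⟩, h4⟩, h6.not_gt⟩
    · rintro ⟨a, b⟩ hp
      simp only [hE, coe_filter, mem_filter, mem_univ, true_and, Set.mem_ofPred_eq, Prod.fst_swap,
        Prod.snd_swap] at hp ⊢
      obtain ⟨⟨⟨⟨h1, h2, h3⟩, h4⟩, h5⟩, h6⟩ := hp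
      exact ⟨⟨⟨⟨mem_above_union_below_comm.1 h1, h3, h2⟩, h5⟩, h4⟩,
        lt_of_le_of_ne (not_lt.1 h6) (h.mem_above_union_below.1 h1).1⟩
  have hgoal : (univ.filter fun p : V × V => (p.1 ∈ S ∧ p.2 ∉ S) ∧
      p.2 ∈ above facets p.1 ∪ below facets p.1 ∧ L ∈ facets p.1 ∧ L ∈ facets p.2) =
      (E.filter (·.1 ∈ S)).filter (·.2 ∉ S) := by
    ext p
    simp only [hE, mem_filter, mem_univ, true_and]
    tauto
  rw [hgoal]
  rw [sum_const, smul_eq_mul] at hall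
  rw [Nat.even_iff]
  omega

/-- In dimension three, at least three edges leave a set of vertices that some edge leaves. -/
theorem three_le_card_boundary (h : SimpleSystem 3 facets) (S : Finset V) {x q : V} (hx : x ∈ S)
    (hq : q ∉ S) (hxq : q ∈ above facets x ∪ below facets x) :
    3 ≤ (univ.filter fun p : V × V => (p.1 ∈ S ∧ p.2 ∉ S) ∧
      p.2 ∈ above facets p.1 ∪ below facets p.1).card := by
  classical
  obtain ⟨hne, i, hi, hs⟩ := h.mem_above_union_below.1 hxq
  have hcard : ((facets x).erase i).card = 2 := by rw [card_erase_of_mem hi, h.card]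
  obtain ⟨L, R, hLR, heq⟩ := card_eq_two.1 hcard
  -- The edge from `x` to `q` lies on two facets. By parity each of them has a second edge leaving
  -- `S`, and these two differ since two facets share at most one edge.
  have other : ∀ M ∈ (facets x).erase i, ∃ p : V × V, p ≠ (x, q) ∧ ((p.1 ∈ S ∧ p.2 ∉ S) ∧
      p.2 ∈ above facets p.1 ∪ below facets p.1 ∧ M ∈ facets p.1 ∧ M ∈ facets p.2) := by
    intro M hM
    have heven := h.even_card_boundary S M
    set B := (univ.filter fun p : V × V => (p.1 ∈ S ∧ p.2 ∉ S) ∧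
      p.2 ∈ above facets p.1 ∪ below facets p.1 ∧ M ∈ facets p.1 ∧ M ∈ facets p.2) with hB
    have hmem : (x, q) ∈ B := by
      simp only [hB, mem_filter, mem_univ, true_and]
      exact ⟨⟨hx, hq⟩, hxq, mem_of_mem_erase hM, hs hM⟩
    have hpos := card_pos.2 ⟨_, hmem⟩
    have hone : 1 < B.card := by
      rcases heven with ⟨r, hr⟩
      omega
    obtain ⟨p, hp, hpne⟩ := exists_mem_ne hone (x, q)
    rw [hB, mem_filter] at hp
    exact ⟨p, hpne, hp.2⟩
  have hLm : L ∈ (facets x).erase i := by rw [heq]; simp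
  have hRm : R ∈ (facets x).erase i := by rw [heq]; simp
  obtain ⟨p, hp, hp1, hp2, hp3, hp4⟩ := other L hLm
  obtain ⟨r, hr, hr1, hr2, hr3, hr4⟩ := other R hRm
  have hpr : p ≠ r := by
    rintro rfl
    obtain ⟨u, -, huniq⟩ := h.nbr x i hi
    have hu : ∀ y, L ∈ facets y → R ∈ facets y → y ≠ x → y = q := by
      intro y hLy hRy hyx
      refine (huniq y ⟨hyx, ?_⟩).trans (huniq q ⟨hne, hs⟩).symm
      rw [heq]
      intro m hm
      rcases mem_insert.1 hm with rfl | hm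
      · exact hLy
      · rw [mem_singleton.1 hm]
        exact hRy
    have h1 : p.1 = x := by
      by_contra hcon
      exact hq (hu _ hp3 hr3 hcon ▸ hp1.1)
    have h2 : p.2 = q := hu _ hp4 hr4 fun hcon => hp1.2 (hcon ▸ hx)
    exact hp (Prod.ext h1 h2)
  have hsub : ({(x, q), p, r} : Finset (V × V)) ⊆ univ.filter fun p : V × V =>
      (p.1 ∈ S ∧ p.2 ∉ S) ∧ p.2 ∈ above facets p.1 ∪ below facets p.1 := by
    intro m hm
    rw [mem_filter]
    refine ⟨mem_univ _, ?_⟩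
    simp only [mem_insert, mem_singleton] at hm
    rcases hm with rfl | rfl | rfl
    · exact ⟨⟨hx, hq⟩, hxq⟩
    · exact ⟨hp1, hp2⟩
    · exact ⟨hr1, hr2⟩
  refine le_trans (le_of_eq ?_) (card_le_card hsub)
  rw [card_insert_of_notMem, card_pair hpr]
  simp [hp.symm, hr.symm]

end Neighbours

end SimpleSystem

end MonotoneDiameter

/-! ### Directed distance levels. -/

namespace MonotoneDiameter

open Finset

section Levels

variable {V : Type*} {R : V → V → Prop}

theorem exists_walk_of_reflTransGen {x u : V} (h : Relation.ReflTransGen R x u) :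
    ∃ k, Walk R k x u := by
  induction h with
  | refl => exact ⟨0, rfl⟩
  | tail _ hr ih => obtain ⟨k, hk⟩ := ih; exact ⟨k + 1, _, hk, hr⟩

open Classical in
/-- The vertices at directed distance `j` from `x`. -/
noncomputable def level [Fintype V] (R : V → V → Prop) (x : V) (j : ℕ) : Finset V :=
  univ.filter fun u => Walk R j x u ∧ ∀ k < j, ¬ Walk R k x u

theorem mem_level [Fintype V] {x u : V} {j : ℕ} :
    u ∈ level R x j ↔ Walk R j x u ∧ ∀ k < j, ¬ Walk R k x u := by simp [level]

theorem level_nonempty [Fintype V] {x u : V} {j L : ℕ} (hu : u ∈ level R x L) (hj : j ≤ L) :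
    (level R x j).Nonempty := by
  induction L, hj using Nat.le_induction generalizing u with
  | base => exact ⟨u, hu⟩
  | succ L hL ih =>
    obtain ⟨⟨y, hy, hr⟩, hmin⟩ := mem_level.1 hu
    exact ih (mem_level.2 ⟨hy, fun k hk hky => hmin (k + 1) (by omega) ⟨y, hky, hr⟩⟩)

theorem pairwiseDisjoint_level [Fintype V] (x : V) (s : Set ℕ) :
    s.PairwiseDisjoint (level R x) := by
  intro a _ b _ hab
  refine disjoint_left.2 fun u ha hb => ?_
  rw [mem_level] at ha hb
  rcases lt_or_gt_of_ne hab with h | h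
  · exact hb.2 a h ha.1
  · exact ha.2 b h hb.1

/-- Either the first level with a single vertex `z` is met before the vertex `w`, or `z = w`: the
vertices that can be reached while avoiding `z` do not include `w`, and there are at least two of
them at each smaller distance. -/
theorem exists_bottleneck [Fintype V] [DecidableEq V] {x w : V} (hxw : x ≠ w)
    (hreach : Relation.ReflTransGen R x w) :
    ∃ (z : V) (i : ℕ) (U : Finset V), 1 ≤ i ∧ Walk R i x z ∧ z ≠ x ∧
      (∀ u, u ∈ U ↔ Relation.ReflTransGen (fun a b => R a b ∧ b ≠ z) x u) ∧
      z ∉ U ∧ w ∉ U ∧ 2 * (i - 1) ≤ (U.erase x).card ∧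
      (2 ≤ i → (level R x 1).card + 2 * (i - 2) ≤ (U.erase x).card) := by
  classical
  have hex := exists_walk_of_reflTransGen hreach
  set L := Nat.find hex with hL
  have hLw : w ∈ level R x L := mem_level.2 ⟨Nat.find_spec hex, fun k hk => Nat.find_min hex hk⟩
  have hL1 : 1 ≤ L := by
    by_contra hcon
    have h0 : L = 0 := by omega
    have := (mem_level.1 hLw).1
    rw [h0] at this
    exact hxw this
  have hexi : ∃ i, 1 ≤ i ∧ (i = L ∨ (level R x i).card = 1) := ⟨L, hL1, Or.inl rfl⟩
  set i := Nat.find hexi with hi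
  obtain ⟨hi1, hi2⟩ := Nat.find_spec hexi
  have hiL : i ≤ L := Nat.find_min' hexi ⟨hL1, Or.inl rfl⟩
  have htwo : ∀ j, 1 ≤ j → j < i → 2 ≤ (level R x j).card := by
    intro j hj1 hji
    have h1 := Nat.find_min hexi hji
    have h2 := card_pos.2 (level_nonempty hLw (hji.le.trans hiL))
    push Not at h1
    have := (h1 hj1).2
    omega
  obtain ⟨z, hz, hzw⟩ : ∃ z ∈ level R x i, z = w ∨ (i < L ∧ level R x i = {z}) := by
    rcases eq_or_ne i L with h | h
    · exact ⟨w, h ▸ hLw, Or.inl rfl⟩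
    · obtain ⟨z, hz⟩ := card_eq_one.1 (hi2.resolve_left h)
      exact ⟨z, by rw [hz]; simp, Or.inr ⟨lt_of_le_of_ne hiL h, hz⟩⟩
  have hzx : z ≠ x := by
    rintro rfl
    exact (mem_level.1 hz).2 0 hi1 rfl
  set U : Finset V := univ.filter fun u => Relation.ReflTransGen (fun a b => R a b ∧ b ≠ z) x u
    with hU
  have hmem : ∀ u, u ∈ U ↔ Relation.ReflTransGen (fun a b => R a b ∧ b ≠ z) x u := by
    intro u; simp [hU]
  have hzU : z ∉ U := by
    rw [hmem]
    intro hcon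
    rcases hcon.cases_tail with h | ⟨y, -, -, h⟩
    · exact hzx h
    · exact h rfl
  have hwU : w ∉ U := by
    rcases hzw with rfl | ⟨hlt, hsing⟩
    · exact hzU
    -- Here level `i` is `{z}`, so a walk avoiding `z` never gets to distance `i`, whereas `w` is
    -- farther away.
    have key : ∀ u, Relation.ReflTransGen (fun a b => R a b ∧ b ≠ z) x u →
        ∃ j < i, Walk R j x u := by
      intro u hu
      induction hu with
      | refl => exact ⟨0, hi1, rfl⟩
      | @tail y u' _ hr ih =>
        obtain ⟨j, hj, hw⟩ := ih
        by_contra hcon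
        push Not at hcon
        have hw' : Walk R (j + 1) x u' := ⟨y, hw, hr.1⟩
        have hji : j + 1 = i := by
          by_contra hne
          exact hcon (j + 1) (by omega) hw'
        have : u' ∈ level R x i := mem_level.2 ⟨hji ▸ hw', hcon⟩
        rw [hsing, mem_singleton] at this
        exact hr.2 this
    intro hcon
    obtain ⟨j, hj, hw⟩ := key w ((hmem w).1 hcon)
    exact (mem_level.1 hLw).2 j (hj.trans hlt) hw
  have hlevU : ∀ j < i, ∀ u, Walk R j x u → u ∈ U := by
    intro j
    induction j with
    | zero =>
      rintro - u rfl
      exact (hmem _).2 .refl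
    | succ j ih =>
      rintro hj u ⟨y, hy, hr⟩
      refine (hmem u).2 (((hmem y).1 (ih (by omega) y hy)).tail ⟨hr, ?_⟩)
      rintro rfl
      exact (mem_level.1 hz).2 _ hj ⟨y, hy, hr⟩
  have hsub : (Ico 1 i).biUnion (level R x) ⊆ U.erase x := by
    intro u hu
    obtain ⟨j, hj, hu⟩ := mem_biUnion.1 hu
    rw [mem_Ico] at hj
    rw [mem_level] at hu
    refine mem_erase.2 ⟨?_, hlevU j hj.2 u hu.1⟩
    rintro rfl
    exact hu.2 0 hj.1 rfl
  have hcard := card_le_card hsub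
  rw [card_biUnion (pairwiseDisjoint_level x _)] at hcard
  refine ⟨z, i, U, hi1, (mem_level.1 hz).1, hzx, hmem, hzU, hwU, le_trans ?_ hcard,
    fun h2 => le_trans ?_ hcard⟩
  · calc 2 * (i - 1) = ∑ j ∈ Ico 1 i, 2 := by simp [mul_comm]
      _ ≤ _ := sum_le_sum fun j hj => htwo j (mem_Ico.1 hj).1 (mem_Ico.1 hj).2
  · rw [sum_eq_sum_Ico_succ_bot (by omega : 1 < i)]
    refine Nat.add_le_add_left ?_ _
    calc 2 * (i - 2) = ∑ j ∈ Ico (1 + 1) i, 2 := by simp [mul_comm]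
      _ ≤ _ := sum_le_sum fun j hj => htwo j (by have := (mem_Ico.1 hj).1; omega) (mem_Ico.1 hj).2

end Levels

/-! ### The monotone Hirsch bound in dimension three. -/

namespace SimpleSystem

variable {ι V : Type*} [DecidableEq ι] [LinearOrder V] {facets : V → Finset ι}

/-- Let `i` be the facet left by the only upward edge at `u`. All edges at `u` within `i` go down,
so `u` is a local maximum of `i`, hence its maximum. -/
theorem exists_facet_max [Fintype V] {d : ℕ} (h : SimpleSystem d facets) {u : V}
    (hu : (above facets u).card = 1) :
    ∃ i ∈ facets u, ∀ v, i ∈ facets v → v ≤ u := by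
  obtain ⟨u', hu'⟩ := card_eq_one.1 hu
  have hup : Up facets u u' := by rw [← mem_above, hu']; simp
  obtain ⟨hlt, i, hi, hs⟩ := hup
  refine ⟨i, hi, fun v hv => h.opt {i} u (by simpa) ?_ v (by simpa)⟩
  intro y hyu hy j hj hsj
  rcases lt_or_gt_of_ne hyu with h1 | h1
  · exact h1
  · have : y ∈ above facets u := mem_above.2 ⟨h1, j, hj, hsj⟩
    rw [hu', mem_singleton] at this
    subst this
    exact absurd (by simpa using hy) (h.notMem_of_erase_subset hyu hs)

theorem reflTransGen_top [Finite V] {d : ℕ} (h : SimpleSystem d facets) {w : V} (hw : ∀ u, u ≤ w)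
    (x : V) : Relation.ReflTransGen (Up facets) x w := by
  have := Fintype.ofFinite V
  induction x using (wellFounded_gt (α := V)).induction with
  | _ x ih =>
    rcases (hw x).eq_or_lt with rfl | hlt
    · exact .refl
    · obtain ⟨u, hu, -⟩ := h.exists_up (K := ∅) (by simp) (by simp) hlt
      exact .head hu (ih u hu.1)

/-- In dimension three, from a vertex `x` with two upper neighbours some vertex `z` can be reached
in a number of steps bounded by the number of intermediate vertices with one upper neighbour. -/
theorem exists_bottleneck_walk [Fintype V] (h : SimpleSystem 3 facets) {x w : V}
    (hw : ∀ u, u ≤ w) (hx : 2 ≤ (above facets x).card) :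
    ∃ (z : V) (i : ℕ) (T : Finset V), x < z ∧ Walk (Up facets) i x z ∧ i ≤ T.card ∧
      ∀ u ∈ T, x < u ∧ u < z ∧ (above facets u).card = 1 := by
  classical
  have hxw : x ≠ w := by
    rintro rfl
    obtain ⟨u, hu⟩ := card_pos.1 (lt_of_lt_of_le zero_lt_two hx)
    exact absurd (hw u) (not_le.2 (mem_above.1 hu).1)
  obtain ⟨z, i, U, hi, hwalk, hzx, hmem, hzU, hwU, hcard, hcard'⟩ :=
    exists_bottleneck hxw (h.reflTransGen_top hw x)
  have hxU : x ∈ U := (hmem x).2 .refl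
  have hclosed : ∀ u ∈ U, ∀ v, Up facets u v → v ≠ z → v ∈ U := fun u hu v huv hvz =>
    (hmem v).2 (((hmem u).1 hu).tail ⟨huv, hvz⟩)
  have hxle : ∀ u ∈ U, u ≠ x → x < u ∧ ∃ y ∈ U, Up facets y u := by
    intro u hu hux
    rcases ((hmem u).1 hu).cases_tail with h' | ⟨y, hy, hyu, -⟩
    · exact absurd h' hux
    · refine ⟨?_, y, (hmem y).2 hy, hyu⟩
      refine lt_of_le_of_lt ?_ hyu.1
      clear hyu
      induction hy with
      | refl => exact le_rfl
      | tail _ hr ih => exact ih.trans hr.1.1.le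
  have hnext : ∀ u ∈ U, (above facets u).Nonempty := by
    intro u hu
    have hne : u ≠ w := fun h' => hwU (h' ▸ hu)
    obtain ⟨v, hv, -⟩ := h.exists_up (K := ∅) (by simp) (by simp) (lt_of_le_of_ne (hw u) hne)
    exact ⟨v, mem_above.2 hv⟩
  have hltz : ∀ u ∈ U, u < z := by
    obtain ⟨m, hm, hmax⟩ := exists_max_image U id ⟨x, hxU⟩
    obtain ⟨v, hv⟩ := hnext m hm
    rw [mem_above] at hv
    have hvz : v = z := by
      by_contra hvz
      exact absurd (hmax v (hclosed m hm v hv hvz)) (not_le.2 hv.1)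
    intro u hu
    exact lt_of_le_of_lt (hmax u hu) (hvz ▸ hv.1)
  set I := U.erase x with hI
  set T := I.filter fun u => (above facets u).card = 1 with hT
  have hzI : z ∉ I := fun h' => hzU (mem_of_mem_erase h')
  refine ⟨z, i, T, hltz x hxU, hwalk, ?_, fun u hu => ?_⟩
  swap
  · rw [hT, mem_filter, hI, mem_erase] at hu
    exact ⟨(hxle u hu.1.2 hu.1.1).1, hltz u hu.1.2, hu.2⟩
  -- degrees
  have hdeg : ∀ u, (above facets u).card + (below facets u).card = 3 :=
    h.card_above_add_card_below
  -- A vertex of `I` has an upper neighbour, not being the top, and a lower one, being reached from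
  -- `x`. So its degree 3 splits as 1 + 2 or 2 + 1.
  have hIdeg : ∀ u ∈ I, (above facets u).card + (if (above facets u).card = 1 then 1 else 0) = 2 := by
    intro u hu
    rw [hI, mem_erase] at hu
    have h1 := card_pos.2 (hnext u hu.2)
    obtain ⟨-, y, -, hy⟩ := hxle u hu.2 hu.1
    have h2 := card_pos.2 ⟨y, mem_below.2 hy⟩
    have h3 := hdeg u
    split_ifs <;> omega
  have hsumI : ∑ u ∈ I, (above facets u).card + T.card = 2 * I.card := by
    rw [hT, card_filter, ← sum_add_distrib, sum_congr rfl hIdeg, sum_const, smul_eq_mul, mul_comm]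
  have hsumI' : ∑ u ∈ I, (above facets u).card + ∑ u ∈ I, (below facets u).card = 3 * I.card := by
    rw [← sum_add_distrib, sum_congr rfl fun u _ => hdeg u, sum_const, smul_eq_mul, mul_comm]
  -- edges out of `U` and edges into `I ∪ {z}`
  set E : Finset (V × V) := univ.filter fun p : V × V => Up facets p.1 p.2 with hE
  have hout : (E.filter (·.1 ∈ U)).card = ∑ u ∈ U, (above facets u).card := by
    rw [card_eq_sum_card_fiberwise (f := Prod.fst) (t := U)]
    · refine sum_congr rfl fun s hs => card_bij (fun p _ => p.2) ?_ ?_ ?_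
      · rintro ⟨a, b⟩ hp
        simp only [hE, mem_filter, mem_univ, true_and] at hp
        obtain ⟨⟨h1, -⟩, rfl⟩ := hp
        exact mem_above.2 h1
      · rintro ⟨a, b⟩ hp ⟨a', b'⟩ hp' hb
        rw [mem_filter] at hp hp'
        exact Prod.ext (hp.2.trans hp'.2.symm) hb
      · intro b hb
        refine ⟨(s, b), ?_, rfl⟩
        simp only [hE, mem_filter, mem_univ, true_and]
        exact ⟨⟨mem_above.1 hb, hs⟩, trivial⟩
    · intro p hp
      exact (mem_filter.1 hp).2
  have hinto : (E.filter (·.2 ∈ insert z I)).card = ∑ u ∈ insert z I, (below facets u).card := by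
    rw [card_eq_sum_card_fiberwise (f := Prod.snd) (t := insert z I)]
    · refine sum_congr rfl fun s hs => card_bij (fun p _ => p.1) ?_ ?_ ?_
      · rintro ⟨a, b⟩ hp
        simp only [hE, mem_filter, mem_univ, true_and] at hp
        obtain ⟨⟨h1, -⟩, rfl⟩ := hp
        exact mem_below.2 h1
      · rintro ⟨a, b⟩ hp ⟨a', b'⟩ hp' hb
        rw [mem_filter] at hp hp'
        exact Prod.ext hb (hp.2.trans hp'.2.symm)
      · intro b hb
        refine ⟨(b, s), ?_, rfl⟩
        simp only [hE, mem_filter, mem_univ, true_and]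
        exact ⟨⟨mem_below.1 hb, hs⟩, trivial⟩
    · intro p hp
      exact (mem_filter.1 hp).2
  have hsub : E.filter (·.1 ∈ U) ⊆ E.filter (·.2 ∈ insert z I) := by
    intro p hp
    simp only [hE, mem_filter, mem_univ, true_and] at hp ⊢
    refine ⟨hp.1, ?_⟩
    by_cases hpz : p.2 = z
    · exact hpz ▸ mem_insert_self _ _
    · refine mem_insert_of_mem (mem_erase.2 ⟨?_, hclosed _ hp.2 _ hp.1 hpz⟩)
      intro h2
      have := hp.1.1
      rw [h2] at this
      by_cases hp1 : p.1 = x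
      · exact this.ne hp1
      · exact lt_asymm this (hxle _ hp.2 hp1).1
  have hslack := card_sdiff_add_card_eq_card hsub
  -- `slack` counts the edges that enter `I ∪ {z}` from outside `U`.
  set slack := (E.filter (·.2 ∈ insert z I) \ E.filter (·.1 ∈ U)).card with hslackdef
  rw [hout, hinto, sum_insert hzI, ← add_sum_erase U _ hxU, ← hI] at hslack
  have hzdeg := hdeg z
  have hxdeg := hdeg x
  have hTI : T.card ≤ I.card := card_filter_le _ _
  -- the boundary of `U ∪ {z}`
  have hbdry : (above facets x).card = 2 → 2 ≤ slack + (above facets z).card := by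
    intro h2
    obtain ⟨q, hq⟩ := card_eq_one.1 (show (below facets x).card = 1 by omega)
    have hqx : Up facets q x := by rw [← mem_below, hq]; simp
    have hqU : q ∉ insert z U := by
      rw [mem_insert]
      rintro (rfl | hqU)
      · exact lt_asymm hqx.1 (hltz x hxU)
      · by_cases hqx' : q = x
        · exact hqx.1.ne hqx'
        · exact lt_asymm hqx.1 (hxle q hqU hqx').1
    have h3 := h.three_le_card_boundary (insert z U) (mem_insert_of_mem hxU) hqU
      (mem_union_right _ (mem_below.2 hqx))
    set B := univ.filter fun p : V × V => (p.1 ∈ insert z U ∧ p.2 ∉ insert z U) ∧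
      p.2 ∈ above facets p.1 ∪ below facets p.1 with hB
    have hBsub : B ⊆ {(x, q)} ∪ (((E.filter (·.2 ∈ insert z I) \ E.filter (·.1 ∈ U)).image
        Prod.swap) ∪ (above facets z).image (fun v => (z, v))) := by
      rintro ⟨s, v⟩ hp
      simp only [hB, mem_filter, mem_univ, true_and] at hp
      obtain ⟨⟨hs, hv⟩, hadj⟩ := hp
      have hvU : v ∉ U := fun h' => hv (mem_insert_of_mem h')
      have hvz : v ≠ z := fun h' => hv (h' ▸ mem_insert_self _ _)
      simp only [mem_union, mem_singleton, mem_image, mem_sdiff, mem_filter]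
      rw [mem_union, mem_above, mem_below] at hadj
      rcases hadj with hup | hdown
      · rcases mem_insert.1 hs with rfl | hs
        · exact Or.inr (Or.inr ⟨v, mem_above.2 hup, rfl⟩)
        · exact absurd (hclosed s hs v hup hvz) hvU
      · by_cases hsx : s = x
        · subst hsx
          have : v ∈ below facets s := mem_below.2 hdown
          rw [hq, mem_singleton] at this
          exact Or.inl (by rw [this])
        · refine Or.inr (Or.inl ⟨(v, s), ⟨⟨by simp [hE, hdown], ?_⟩, fun h' => hvU h'.2⟩, rfl⟩)
          rcases mem_insert.1 hs with rfl | hs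
          · exact mem_insert_self _ _
          · exact mem_insert_of_mem (mem_erase.2 ⟨hsx, hs⟩)
    have h4 := (card_le_card hBsub).trans ((card_union_le _ _).trans
      (Nat.add_le_add_left ((card_union_le _ _).trans
        (Nat.add_le_add card_image_le card_image_le)) _))
    rw [card_singleton, ← hslackdef] at h4
    omega
  have hlev : level (Up facets) x 1 = above facets x := by
    ext u
    rw [mem_level, mem_above]
    constructor
    · rintro ⟨⟨y, rfl, hy⟩, -⟩
      exact hy
    · intro hu
      refine ⟨Walk.single hu, fun k hk => ?_⟩
      have : k = 0 := by omega
      subst this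
      exact hu.1.ne
  rw [hlev] at hcard'
  have hIpos : 1 ≤ I.card := by
    obtain ⟨u, hu, huz⟩ := exists_mem_ne (lt_of_lt_of_le one_lt_two hx) z
    rw [mem_above] at hu
    exact card_pos.2 ⟨u, mem_erase.2 ⟨hu.1.ne', hclosed x hxU u hu huz⟩⟩
  -- With `a` for the number of upper neighbours, the count gives `2 * |T| + 3 = |I| + a x + a z +
  -- slack`. If `a x = 2`, then `hbdry` and `|I| ≥ 2 * (i - 1)` give `2 * |T| ≥ 2 * i - 1`. If `a x
  -- = 3`, the same follows from `|I| ≥ 3 + 2 * (i - 2)`, or from `|I| ≥ 1` when `i = 1`.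
  by_cases h2 : (above facets x).card = 2
  · have := hbdry h2
    omega
  · by_cases hi2 : 2 ≤ i
    · have := hcard' hi2
      omega
    · omega

open Classical in
/-- The facets with a vertex that is not below `x`. -/
noncomputable def alive [Fintype ι] (facets : V → Finset ι) (x : V) : Finset ι :=
  univ.filter fun i => ∃ u, x ≤ u ∧ i ∈ facets u

/-- Each vertex of `T` is the maximum of a facet. These facets are distinct, as a facet has one
maximum; they are alive at `x` and dead at `z`. -/
theorem card_le_card_alive [Fintype ι] [Fintype V] {d : ℕ} (h : SimpleSystem d facets) {x z : V}
    (T : Finset V) (hxz : x ≤ z) (hT : ∀ u ∈ T, x ≤ u ∧ u < z ∧ (above facets u).card = 1) :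
    T.card + (alive facets z).card ≤ (alive facets x).card := by
  classical
  rcases isEmpty_or_nonempty ι with hι | hι
  · have hT0 : T = ∅ := eq_empty_of_forall_notMem fun u hu =>
      hι.elim (h.exists_facet_max (hT u hu).2.2).choose
    rw [hT0, eq_empty_of_isEmpty (alive facets z)]
    simp
  choose! f hf hmax using fun u (hu : u ∈ T) => h.exists_facet_max (u := u) (hT u hu).2.2
  have hinj : Set.InjOn f T := fun a ha b hb hab =>
    le_antisymm (hmax b hb a (hab ▸ hf a ha)) (hmax a ha b (hab ▸ hf b hb))
  have hdisj : Disjoint (T.image f) (alive facets z) := by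
    rw [disjoint_left]
    intro i hi hi'
    obtain ⟨u, hu, rfl⟩ := mem_image.1 hi
    simp only [alive, mem_filter, mem_univ, true_and] at hi'
    obtain ⟨v, hzv, hv⟩ := hi'
    exact absurd ((hmax u hu v hv).trans_lt (hT u hu).2.1) (not_lt.2 hzv)
  rw [← card_image_of_injOn hinj, ← card_union_of_disjoint hdisj]
  refine card_le_card (union_subset ?_ ?_)
  · intro i hi
    obtain ⟨u, hu, rfl⟩ := mem_image.1 hi
    simp only [alive, mem_filter, mem_univ, true_and]
    exact ⟨u, (hT u hu).1, hf u hu⟩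
  · intro i hi
    simp only [alive, mem_filter, mem_univ, true_and] at hi ⊢
    obtain ⟨u, hu, hiu⟩ := hi
    exact ⟨u, hxz.trans hu, hiu⟩

/-- The monotone Hirsch bound in dimension three. -/
theorem exists_walk_three [Fintype ι] [Finite V] (h : SimpleSystem 3 facets) {w : V}
    (hw : ∀ u, u ≤ w) (x : V) :
    ∃ k, Walk (Up facets) k x w ∧ k + 3 ≤ (alive facets x).card := by
  have := Fintype.ofFinite V
  induction x using (wellFounded_gt (α := V)).induction with
  | _ x ih =>
    rcases (hw x).eq_or_lt with rfl | hlt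
    · refine ⟨0, rfl, ?_⟩
      rw [zero_add, ← h.card x]
      refine card_le_card fun i hi => ?_
      simp only [alive, mem_filter, mem_univ, true_and]
      exact ⟨x, le_rfl, hi⟩
    · suffices hs : ∃ (z : V) (i : ℕ) (T : Finset V), x < z ∧ Walk (Up facets) i x z ∧
          i ≤ T.card ∧ ∀ u ∈ T, x ≤ u ∧ u < z ∧ (above facets u).card = 1 by
        obtain ⟨z, i, T, hxz, hi, hiT, hT⟩ := hs
        obtain ⟨k, hk, hk3⟩ := ih z hxz
        have := h.card_le_card_alive T hxz.le hT
        exact ⟨i + k, hi.trans hk, by omega⟩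
      obtain ⟨u, hu, -⟩ := h.exists_up (K := ∅) (by simp) (by simp) hlt
      have hpos := card_pos.2 ⟨u, mem_above.2 hu⟩
      rcases Nat.lt_or_eq_of_le hpos with h2 | h1
      · obtain ⟨z, i, T, hxz, hi, hiT, hT⟩ := h.exists_bottleneck_walk hw h2
        exact ⟨z, i, T, hxz, hi, hiT, fun u hu => ⟨(hT u hu).1.le, (hT u hu).2⟩⟩
      · refine ⟨u, 1, {x}, hu.1, Walk.single hu, by simp, fun v hv => ?_⟩
        rw [mem_singleton.1 hv]
        exact ⟨le_rfl, hu.1, h1.symm⟩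

/-- In dimension five with ten facets, seven steps lead from any vertex to the top. -/
theorem exists_walk_five [Fintype ι] [Finite V] (h : SimpleSystem 5 facets)
    (hι : Fintype.card ι = 10) {w : V} (hw : ∀ u, u ≤ w) (v : V) :
    ∃ k ≤ 7, Walk (Up facets) k v w := by
  obtain ⟨y, j, hj, hvy, hcard⟩ := h.exists_two_steps hι (v := v) hw
  obtain ⟨K, hK, hK2⟩ := exists_subset_card_eq hcard
  have hlink := h.link K (e := 3) (by omega)
  obtain ⟨k, hk, hk3⟩ := hlink.exists_walk_three (w := ⟨w, hK.trans inter_subset_right⟩)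
    (fun u => hw u.1) ⟨y, hK.trans inter_subset_left⟩
  -- The two facets of `K` do not count as facets of the 3-face, so at most 8 are alive and `k ≤ 5`.
  have hle : (alive (fun v : {v : V // K ⊆ facets v} => facets v \ K)
      ⟨y, hK.trans inter_subset_left⟩).card ≤ Kᶜ.card := by
    refine card_le_card fun i hi => ?_
    simp only [alive, mem_filter, mem_univ, true_and, mem_sdiff] at hi
    obtain ⟨u, -, hu⟩ := hi
    exact mem_compl.2 hu.2
  rw [card_compl, hι, hK2] at hle
  exact ⟨j + k, by omega, hvy.trans (walk_of_link hk)⟩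

end SimpleSystem

end MonotoneDiameter

/-! ### Simple systems of linear inequalities and their vertices. -/

namespace MonotoneDiameter

open Finset Module

section HalfSpaces

variable {W ι : Type*} [AddCommGroup W] [Module ℝ W] [Fintype ι]

/-- The points satisfying the inequalities `ℓ i x ≤ b i`. -/
def Feasible (ℓ : ι → Dual ℝ W) (b : ι → ℝ) (x : W) : Prop := ∀ i, ℓ i x ≤ b i

open Classical in
/-- The inequalities that are equalities at `x`. -/
noncomputable def tight (ℓ : ι → Dual ℝ W) (b : ι → ℝ) (x : W) : Finset ι :=
  univ.filter fun i => ℓ i x = b i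

theorem mem_tight {ℓ : ι → Dual ℝ W} {b : ι → ℝ} {x : W} {i : ι} :
    i ∈ tight ℓ b x ↔ ℓ i x = b i := by simp [tight]

/-- `d` linearly independent functionals on a space of dimension `d` have a dual basis. -/
theorem exists_dual_vectors [FiniteDimensional ℝ W] [DecidableEq ι] (ℓ : ι → Dual ℝ W)
    {T : Finset ι} (hT : LinearIndependent ℝ fun i : T => ℓ i) (hc : T.card = finrank ℝ W) :
    ∃ e : ι → W, (∀ i ∈ T, ∀ j ∈ T, ℓ j (e i) = if j = i then 1 else 0) ∧
      ∀ y, y = ∑ i ∈ T, ℓ i y • e i := by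
  have hsep : ∀ y : W, (∀ i ∈ T, ℓ i y = 0) → y = 0 := by
    intro y hy
    have hspan : Submodule.span ℝ (Set.range fun i : T => ℓ i) = ⊤ :=
      hT.span_eq_top_of_card_eq_finrank' (by
        rw [Fintype.card_coe, hc, Subspace.dual_finrank_eq])
    rw [← forall_dual_apply_eq_zero_iff ℝ]
    intro f
    have hf : f ∈ Submodule.span ℝ (Set.range fun i : T => ℓ i) := by rw [hspan]; trivial
    induction hf using Submodule.span_induction with
    | mem f hf => obtain ⟨i, rfl⟩ := hf; exact hy i i.2
    | zero => simp
    | add f g _ _ hf hg => simp [hf, hg]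
    | smul c f _ hf => simp [hf]
  let B : Basis T ℝ (Dual ℝ W) := basisOfLinearIndependentOfCardEqFinrank' (K := ℝ)
    (fun i : T => ℓ i) hT (by rw [Fintype.card_coe, hc, Subspace.dual_finrank_eq])
  have hB : ∀ i : T, B i = ℓ i := fun i => by
    simp [B]
  let e : ι → W := fun i => if hi : i ∈ T then (evalEquiv ℝ W).symm (B.dualBasis ⟨i, hi⟩) else 0
  have he : ∀ i ∈ T, ∀ j ∈ T, ℓ j (e i) = if j = i then 1 else 0 := by
    intro i hi j hj
    simp only [e, hi, dif_pos]
    rw [apply_evalEquiv_symm_apply, ← hB ⟨j, hj⟩, Basis.dualBasis_apply_self]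
    simp
  refine ⟨e, he, fun y => ?_⟩
  rw [← sub_eq_zero]
  refine hsep _ fun j hj => ?_
  rw [map_sub, map_sum, sum_eq_single j]
  · simp [he j hj j hj]
  · intro i hi hij
    simp [he i hi j hj, hij.symm]
  · exact fun h => absurd hj h

/-- The ratio test of the simplex method: follow the ray until the first new inequality becomes
tight. -/
theorem exists_exit {ℓ : ι → Dual ℝ W} {b : ι → ℝ} {x y : W} (hx : Feasible ℓ b x)
    (hy : ∃ k, 0 < ℓ k y) (htight : ∀ i ∈ tight ℓ b x, ℓ i y ≤ 0) :
    ∃ s : ℝ, 0 < s ∧ Feasible ℓ b (x + s • y) ∧ ∃ k, 0 < ℓ k y ∧ k ∈ tight ℓ b (x + s • y) := by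
  classical
  obtain ⟨k, hk, hmin⟩ := exists_min_image (univ.filter fun k => 0 < ℓ k y)
    (fun k => (b k - ℓ k x) / ℓ k y) (by obtain ⟨k, hk⟩ := hy; exact ⟨k, by simpa using hk⟩)
  simp only [mem_filter, mem_univ, true_and] at hk hmin
  refine ⟨(b k - ℓ k x) / ℓ k y, div_pos (sub_pos.2 (lt_of_le_of_ne (hx k) fun h => ?_)) hk,
    fun j => ?_, k, hk, mem_tight.2 ?_⟩
  · exact absurd (htight k (mem_tight.2 h)) (not_le.2 hk)
  · have hs : 0 ≤ (b k - ℓ k x) / ℓ k y := div_nonneg (sub_nonneg.2 (hx k)) hk.le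
    rw [map_add, map_smul, smul_eq_mul]
    rcases le_or_gt (ℓ j y) 0 with hj | hj
    · have := hx j
      nlinarith [mul_nonneg hs (neg_nonneg.2 hj)]
    · have := hmin j hj
      rw [le_div_iff₀ hj] at this
      linarith
  · rw [map_add, map_smul, smul_eq_mul, div_mul_cancel₀ _ hk.ne']
    ring

variable (ℓ : ι → Dual ℝ W) (b : ι → ℝ)

/-- The system `ℓ i x ≤ b i` has trivial recession cone, and the equalities at each point of the
space are independent. -/
structure IsSimple : Prop where
  recession : ∀ y, (∀ i, ℓ i y ≤ 0) → y = 0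
  indep : ∀ x, LinearIndependent ℝ fun i : tight ℓ b x => ℓ i

/-- The points that satisfy as many equalities as the dimension of the space. -/
abbrev HVertex : Type _ := {x : W // Feasible ℓ b x ∧ (tight ℓ b x).card = finrank ℝ W}

variable {ℓ b}

namespace IsSimple

variable [FiniteDimensional ℝ W]

theorem card_le (h : IsSimple ℓ b) (x : W) : (tight ℓ b x).card ≤ finrank ℝ W := by
  have := (h.indep x).fintype_card_le_finrank
  rwa [Fintype.card_coe, Subspace.dual_finrank_eq] at this

theorem eq_of_tight_subset (h : IsSimple ℓ b) {x : HVertex ℓ b} {y : W}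
    (hxy : tight ℓ b x.1 ⊆ tight ℓ b y) : y = x := by
  classical
  obtain ⟨e, -, he⟩ := exists_dual_vectors ℓ (h.indep x.1) x.2.2
  rw [← sub_eq_zero, he (y - x.1)]
  refine sum_eq_zero fun i hi => ?_
  rw [map_sub, mem_tight.1 (hxy hi), mem_tight.1 hi, sub_self, zero_smul]

theorem finite (h : IsSimple ℓ b) : Finite (HVertex ℓ b) :=
  Finite.of_injective (fun x : HVertex ℓ b => tight ℓ b x.1) fun x y hxy =>
    Subtype.ext (h.eq_of_tight_subset (x := y) (y := x.1) (Eq.superset hxy))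

/-- Take a feasible point with the most tight inequalities. With fewer than the dimension, one could
move along a direction keeping them all tight until another becomes tight. -/
theorem nonempty (h : IsSimple ℓ b) {z : W} (hz : Feasible ℓ b z) : Nonempty (HVertex ℓ b) := by
  classical
  obtain ⟨m, ⟨x, hx, hxm⟩, hmax⟩ := Set.exists_max_image
    {m : ℕ | ∃ x, Feasible ℓ b x ∧ (tight ℓ b x).card = m} id
    ((Set.finite_Iic (finrank ℝ W)).subset (by
      rintro m ⟨x, -, rfl⟩
      exact h.card_le x)) ⟨_, z, hz, rfl⟩
  refine ⟨x, hx, le_antisymm (h.card_le x) (not_lt.1 fun hlt => ?_)⟩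
  obtain ⟨y, hy0, hy⟩ : ∃ y : W, y ≠ 0 ∧ ∀ i ∈ tight ℓ b x, ℓ i y = 0 := by
    let f : W →ₗ[ℝ] (tight ℓ b x → ℝ) := LinearMap.pi fun i => ℓ i
    have : LinearMap.ker f ≠ ⊥ := LinearMap.ker_ne_bot_of_finrank_lt (by simpa using hlt)
    obtain ⟨y, hy, hy0⟩ := Submodule.exists_mem_ne_zero_of_ne_bot this
    exact ⟨y, hy0, fun i hi => congrFun (LinearMap.mem_ker.1 hy) ⟨i, hi⟩⟩
  have hexit : ∃ k, 0 < ℓ k y := by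
    by_contra! hcon
    exact hy0 (h.recession y hcon)
  obtain ⟨s, -, hfeas, k, hk, hkt⟩ := exists_exit hx hexit fun i hi => (hy i hi).le
  have hkx : k ∉ tight ℓ b x := fun hkx => hk.ne' (hy k hkx)
  have hsub : insert k (tight ℓ b x) ⊆ tight ℓ b (x + s • y) := by
    refine insert_subset hkt fun i hi => ?_
    rw [mem_tight, map_add, map_smul, hy i hi, smul_zero, add_zero, mem_tight.1 hi]
  have h1 := card_le_card hsub
  rw [card_insert_of_notMem hkx] at h1
  have h2 := hmax _ ⟨_, hfeas, rfl⟩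
  simp only [id] at h2
  omega

variable [DecidableEq ι]

/-- The neighbour is the exit point in direction `-e i`, where `e` is the dual basis of the tight
functionals: only inequality `i` is relaxed. -/
theorem exists_neighbour (h : IsSimple ℓ b) (x : HVertex ℓ b) {i : ι} (hi : i ∈ tight ℓ b x.1) :
    ∃ u : HVertex ℓ b, u ≠ x ∧ (tight ℓ b x.1).erase i ⊆ tight ℓ b u.1 := by
  obtain ⟨e, he, -⟩ := exists_dual_vectors ℓ (h.indep x.1) x.2.2
  have hii := he i hi i hi
  rw [if_pos rfl] at hii
  have hexit : ∃ k, 0 < ℓ k (-e i) := by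
    by_contra! hcon
    have h0 := h.recession _ hcon
    rw [neg_eq_zero] at h0
    simp [h0] at hii
  have hzero : ∀ j ∈ tight ℓ b x.1, j ≠ i → ℓ j (-e i) = 0 := fun j hj hji => by
    rw [map_neg, he i hi j hj, if_neg hji, neg_zero]
  have htight : ∀ j ∈ tight ℓ b x.1, ℓ j (-e i) ≤ 0 := by
    intro j hj
    by_cases hji : j = i
    · rw [hji, map_neg, hii]; norm_num
    · exact (hzero j hj hji).le
  obtain ⟨s, hs, hfeas, k, hk, hkt⟩ := exists_exit x.2.1 hexit htight
  have hsub : (tight ℓ b x.1).erase i ⊆ tight ℓ b (x.1 + s • -e i) := by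
    intro j hj
    rw [mem_erase] at hj
    rw [mem_tight, map_add, map_smul, hzero j hj.2 hj.1, smul_zero, add_zero, mem_tight.1 hj.2]
  have hkx : k ∉ tight ℓ b x.1 := fun hkx => absurd (htight k hkx) (not_le.2 hk)
  have hcard : (tight ℓ b (x.1 + s • -e i)).card = finrank ℝ W := by
    refine le_antisymm (h.card_le _) ?_
    have h1 := card_le_card (insert_subset hkt hsub)
    rw [card_insert_of_notMem fun h' => hkx (mem_of_mem_erase h'), card_erase_of_mem hi,
      x.2.2] at h1
    have := card_pos.2 ⟨i, hi⟩
    rw [x.2.2] at this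
    omega
  refine ⟨⟨_, hfeas, hcard⟩, fun heq => hkx ?_, hsub⟩
  rw [← heq]
  exact hkt

theorem neighbour_unique (h : IsSimple ℓ b) (x : HVertex ℓ b) {i : ι} (hi : i ∈ tight ℓ b x.1)
    {u v : HVertex ℓ b} (hux : u ≠ x) (hu : (tight ℓ b x.1).erase i ⊆ tight ℓ b u.1)
    (hvx : v ≠ x) (hv : (tight ℓ b x.1).erase i ⊆ tight ℓ b v.1) : u = v := by
  obtain ⟨e, -, he⟩ := exists_dual_vectors ℓ (h.indep x.1) x.2.2
  have hline : ∀ y : HVertex ℓ b, y ≠ x → (tight ℓ b x.1).erase i ⊆ tight ℓ b y.1 →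
      ∃ s : ℝ, 0 < s ∧ y.1 = x.1 + s • -e i := by
    intro y hyx hy
    have h1 := he (y.1 - x.1)
    rw [sum_eq_single_of_mem i hi] at h1
    · have h2 : 0 ≤ -ℓ i (y.1 - x.1) := by
        have := y.2.1 i
        rw [map_sub, mem_tight.1 hi]
        linarith
      refine ⟨-ℓ i (y.1 - x.1), lt_of_le_of_ne h2 fun h0 => hyx (Subtype.ext ?_), ?_⟩
      · rw [← sub_eq_zero, h1, neg_eq_zero.1 h0.symm, zero_smul]
      · rw [smul_neg, neg_smul, neg_neg, ← h1]
        abel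
    · intro j hj hji
      rw [map_sub, mem_tight.1 hj, mem_tight.1 (hy (mem_erase.2 ⟨hji, hj⟩)), sub_self, zero_smul]
  -- The inequality that becomes tight at `y` but is strict at `x` is violated farther along the
  -- ray.
  have hnlt : ∀ (y z : HVertex ℓ b) (s t : ℝ), y ≠ x → (tight ℓ b x.1).erase i ⊆ tight ℓ b y.1 →
      0 < s → y.1 = x.1 + s • -e i → z.1 = x.1 + t • -e i → ¬ s < t := by
    intro y z s t hyx hy hs hys hzt hst
    obtain ⟨k, hk, hkx⟩ : ∃ k ∈ tight ℓ b y.1, k ∉ tight ℓ b x.1 := by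
      by_contra! hcon
      exact hyx (Subtype.ext (h.eq_of_tight_subset (x := y) (y := x.1) hcon)).symm
    have h1 := mem_tight.1 hk
    have h2 : ℓ k x.1 < b k := lt_of_le_of_ne (x.2.1 k) fun h' => hkx (mem_tight.2 h')
    have h3 := z.2.1 k
    rw [hys, map_add, map_smul, smul_eq_mul] at h1
    rw [hzt, map_add, map_smul, smul_eq_mul] at h3
    have h4 : 0 < ℓ k (-e i) := by
      by_contra hcon
      nlinarith
    nlinarith
  obtain ⟨s, hs, hus⟩ := hline u hux hu
  obtain ⟨t, ht, hvt⟩ := hline v hvx hv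
  have hst : s = t := le_antisymm (not_lt.1 (hnlt v u t s hvx hv ht hvt hus))
    (not_lt.1 (hnlt u v s t hux hu hs hus hvt))
  exact Subtype.ext (by rw [hus, hvt, hst])

/-- A local maximum on a face is a global maximum on this face. -/
theorem le_of_forall_neighbour (h : IsSimple ℓ b) (ψ : Dual ℝ W) (x : HVertex ℓ b)
    {K : Finset ι} (hK : K ⊆ tight ℓ b x.1)
    (hloc : ∀ u : HVertex ℓ b, u ≠ x → K ⊆ tight ℓ b u.1 → ∀ i ∈ tight ℓ b x.1,
      (tight ℓ b x.1).erase i ⊆ tight ℓ b u.1 → ψ u ≤ ψ x)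
    {z : W} (hz : Feasible ℓ b z) (hKz : K ⊆ tight ℓ b z) : ψ z ≤ ψ x := by
  obtain ⟨e, he, hrepr⟩ := exists_dual_vectors ℓ (h.indep x.1) x.2.2
  -- In the dual basis `z - x` has coordinates `ℓ i z - b i ≤ 0`, which vanish for `i ∈ K`. For
  -- other `i`, `ψ (e i) ≥ 0` because the neighbour in direction `-e i` is no higher than `x`.
  rw [← sub_nonpos, ← map_sub, hrepr (z - x.1), map_sum]
  refine sum_nonpos fun i hi => ?_
  rw [map_smul, smul_eq_mul, map_sub, mem_tight.1 hi]
  have h1 : ℓ i z - b i ≤ 0 := sub_nonpos.2 (hz i)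
  by_cases hiK : i ∈ K
  · rw [mem_tight.1 (hKz hiK), sub_self, zero_mul]
  · refine mul_nonpos_of_nonpos_of_nonneg h1 ?_
    obtain ⟨u, hux, hu⟩ := h.exists_neighbour x hi
    have hKu : K ⊆ tight ℓ b u.1 := fun k hk =>
      hu (mem_erase.2 ⟨fun h' => hiK (h' ▸ hk), hK hk⟩)
    have h2 := hloc u hux hKu i hi hu
    have h3 := hrepr (u.1 - x.1)
    rw [sum_eq_single_of_mem i hi] at h3
    · have h4 : ℓ i (u.1 - x.1) < 0 := by
        refine lt_of_le_of_ne ?_ fun h0 => hux (Subtype.ext ?_)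
        · rw [map_sub, mem_tight.1 hi]
          exact sub_nonpos.2 (u.2.1 i)
        · rw [h0, zero_smul] at h3
          exact sub_eq_zero.1 h3
      rw [← sub_nonpos, ← map_sub, h3, map_smul, smul_eq_mul] at h2
      by_contra hcon
      nlinarith
    · intro j hj hji
      rw [map_sub, mem_tight.1 hj, mem_tight.1 (hu (mem_erase.2 ⟨hji, hj⟩)), sub_self, zero_smul]

/-- A functional with distinct values at the vertices orders them as in a simple polytope. -/
theorem simpleSystem (h : IsSimple ℓ b) {d : ℕ} (hd : finrank ℝ W = d) (ψ : Dual ℝ W)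
    (hψ : Function.Injective fun x : HVertex ℓ b => ψ x.1) :
    @SimpleSystem ι (HVertex ℓ b) _ (LinearOrder.lift' _ hψ) d
      (fun x => tight ℓ b x.1) := by
  let : LinearOrder (HVertex ℓ b) := LinearOrder.lift' _ hψ
  refine ⟨fun v => v.2.2.trans hd, fun x y hxy => ?_, fun x i hi => ?_, fun K x hK hloc u hu => ?_⟩
  · exact Subtype.ext (h.eq_of_tight_subset (x := y) (y := x.1) (Eq.superset hxy))
  · obtain ⟨u, hux, hu⟩ := h.exists_neighbour x hi
    exact ⟨u, ⟨hux, hu⟩, fun v hv => h.neighbour_unique x hi hv.1 hv.2 hux hu⟩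
  · exact h.le_of_forall_neighbour ψ x hK
      (fun u hux hKu i hi hiu => (hloc u hux hKu i hi hiu).le) u.2.1 hu

theorem exists_forall_le (h : IsSimple ℓ b) {z : W} (hz : Feasible ℓ b z) (ψ : Dual ℝ W) :
    ∃ x : HVertex ℓ b, ∀ z, Feasible ℓ b z → ψ z ≤ ψ x := by
  have := h.finite
  have := h.nonempty hz
  obtain ⟨x, hx⟩ := Finite.exists_max fun x : HVertex ℓ b => ψ x.1
  exact ⟨x, fun z hz => h.le_of_forall_neighbour ψ x (K := ∅) (by simp)
    (fun u _ _ _ _ _ => hx u) hz (by simp)⟩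

end IsSimple

end HalfSpaces

end MonotoneDiameter

/-! ### Perturbation to a simple system, and projection back. -/

namespace MonotoneDiameter

open Finset Module Filter Topology

theorem eventually_add_mul_ne_zero (a : ℝ) {c : ℝ} (hc : c ≠ 0) :
    ∀ᶠ s in 𝓝[>] (0 : ℝ), a + s * c ≠ 0 := by
  by_cases ha : a = 0
  · filter_upwards [self_mem_nhdsWithin] with s hs
    rw [ha, zero_add]
    exact mul_ne_zero (ne_of_gt hs) hc
  · have h1 : Tendsto (fun s : ℝ => a + s * c) (𝓝 0) (𝓝 (a + 0 * c)) :=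
      (by fun_prop : Continuous fun s : ℝ => a + s * c).tendsto 0
    rw [zero_mul, add_zero] at h1
    exact (h1.eventually_ne ha).filter_mono nhdsWithin_le_nhds

theorem eventually_add_mul_pos {a : ℝ} (c : ℝ) (ha : 0 < a) :
    ∀ᶠ s in 𝓝[>] (0 : ℝ), 0 < a + s * c := by
  have h1 : Tendsto (fun s : ℝ => a + s * c) (𝓝 0) (𝓝 (a + 0 * c)) :=
    (by fun_prop : Continuous fun s : ℝ => a + s * c).tendsto 0
  rw [zero_mul, add_zero] at h1
  exact (h1.eventually_const_lt ha).filter_mono nhdsWithin_le_nhds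

variable {W ι : Type*} [AddCommGroup W] [Module ℝ W]

/-- A functional can be perturbed to separate finitely many points, respecting the order of
the points with distinct values. -/
theorem exists_injective_dual {κ : Type*} [Finite κ] (φ : Dual ℝ W) {x : κ → W}
    (hx : Function.Injective x) :
    ∃ φ' : Dual ℝ W, Function.Injective (fun k => φ' (x k)) ∧
      ∀ j k, φ' (x j) < φ' (x k) → φ (x j) ≤ φ (x k) := by
  obtain ⟨ψ, hψ⟩ := exists_dual_forall_apply_ne_zero (K := ℝ)
    (fun p : {p : κ × κ // p.1 ≠ p.2} => x p.1.1 - x p.1.2)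
    (fun p => sub_ne_zero.2 fun h => p.2 (hx h))
  have h1 : ∀ᶠ s in 𝓝[>] (0 : ℝ), ∀ p : {p : κ × κ // p.1 ≠ p.2},
      φ (x p.1.1 - x p.1.2) + s * ψ (x p.1.1 - x p.1.2) ≠ 0 :=
    eventually_all.2 fun p => eventually_add_mul_ne_zero _ (hψ p)
  have h2 : ∀ᶠ s in 𝓝[>] (0 : ℝ), ∀ p : κ × κ, 0 < φ (x p.1 - x p.2) →
      0 < φ (x p.1 - x p.2) + s * ψ (x p.1 - x p.2) :=
    eventually_all.2 fun p => by
      by_cases hp : 0 < φ (x p.1 - x p.2)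
      · exact (eventually_add_mul_pos _ hp).mono fun s hs _ => hs
      · exact Eventually.of_forall fun s h => absurd h hp
  obtain ⟨s, hs1, hs2⟩ := (h1.and h2).exists
  refine ⟨φ + s • ψ, fun j k hjk => ?_, fun j k hjk => ?_⟩
  · by_contra hne
    refine hs1 ⟨(j, k), hne⟩ ?_
    simp only [LinearMap.add_apply, LinearMap.smul_apply, smul_eq_mul] at hjk
    simp only [map_sub]
    linarith
  · by_contra! hcon
    have := hs2 (j, k) (by simpa using hcon)
    simp only [LinearMap.add_apply, LinearMap.smul_apply, smul_eq_mul] at hjk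
    simp only [map_sub] at this
    linarith

variable [Fintype ι]

/-- The right-hand sides of a system can be increased slightly to make the system simple. -/
theorem exists_isSimple {ℓ : ι → Dual ℝ W} (hrec : ∀ y, (∀ i, ℓ i y ≤ 0) → y = 0) (b : ι → ℝ)
    {p : (ι → ℝ) → Prop} (hp : ∀ᶠ c in 𝓝 b, p c) :
    ∃ c, (∀ i, b i ≤ c i) ∧ IsSimple ℓ c ∧ p c := by
  classical
  have hdep : ∀ S : {S : Finset ι // ¬ LinearIndependent ℝ fun i : S => ℓ i}, ∃ g : ι → ℝ,
      ∑ i ∈ S.1, g i • ℓ i = 0 ∧ ∃ i ∈ S.1, g i ≠ 0 := by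
    rintro ⟨S, hS⟩
    obtain ⟨g, hg, i, hi⟩ := Fintype.not_linearIndependent_iff.1 hS
    refine ⟨fun i => if hi : i ∈ S then g ⟨i, hi⟩ else 0, ?_, i, i.2, by simpa using hi⟩
    rw [← hg, ← sum_attach]
    exact sum_congr rfl fun i _ => by simp
  choose g hg hg0 using hdep
  -- A linear relation among the functionals of `S` also holds for their right-hand sides if all of
  -- `S` is tight at one point. So `f S c ≠ 0` prevents this for the right-hand sides `c`.
  let f : {S : Finset ι // ¬ LinearIndependent ℝ fun i : S => ℓ i} → Dual ℝ (ι → ℝ) :=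
    fun S => ∑ i ∈ S.1, g S i • LinearMap.proj i
  have hf : ∀ S c, f S c = ∑ i ∈ S.1, g S i * c i := fun S c => by
    simp [f, LinearMap.sum_apply]
  obtain ⟨δ, hδ⟩ := Dual.exists_forall_ne_zero_of_forall_exists f fun S => by
    obtain ⟨i, hi, hi0⟩ := hg0 S
    refine ⟨Pi.single i 1, ?_⟩
    rw [hf, sum_eq_single_of_mem i hi fun j _ hji => by simp [hji]]
    simpa using hi0
  -- a nonnegative generic direction
  have h1 : ∀ᶠ s in 𝓝[>] (0 : ℝ), ∀ S, f S (fun _ => 1) + s * f S δ ≠ 0 :=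
    eventually_all.2 fun S => eventually_add_mul_ne_zero _ (hδ S)
  have h2 : ∀ᶠ s in 𝓝[>] (0 : ℝ), ∀ i, 0 < 1 + s * δ i :=
    eventually_all.2 fun i => eventually_add_mul_pos _ one_pos
  obtain ⟨s, hs1, hs2⟩ := (h1.and h2).exists
  set η : ι → ℝ := (fun _ => 1) + s • δ with hη
  have hfη : ∀ S, f S η ≠ 0 := fun S => by
    rw [hη, map_add, map_smul, smul_eq_mul]
    exact hs1 S
  have h3 : ∀ᶠ t in 𝓝[>] (0 : ℝ), ∀ S, f S b + t * f S η ≠ 0 :=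
    eventually_all.2 fun S => eventually_add_mul_ne_zero _ (hfη S)
  have h4 : ∀ᶠ t in 𝓝[>] (0 : ℝ), p (b + t • η) := by
    have h5 : Tendsto (fun t : ℝ => b + t • η) (𝓝 0) (𝓝 (b + (0 : ℝ) • η)) :=
      (by fun_prop : Continuous fun t : ℝ => b + t • η).tendsto 0
    rw [zero_smul, add_zero] at h5
    exact (h5.eventually hp).filter_mono nhdsWithin_le_nhds
  obtain ⟨t, ⟨ht3, ht4⟩, ht⟩ := ((h3.and h4).and self_mem_nhdsWithin).exists
  refine ⟨b + t • η, fun i => ?_, ⟨hrec, fun x => ?_⟩, ht4⟩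
  · have := mul_pos (show (0 : ℝ) < t from ht) (hs2 i)
    simp only [hη, Pi.add_apply, Pi.smul_apply, smul_eq_mul]
    linarith
  · by_contra hcon
    refine ht3 ⟨_, hcon⟩ ?_
    rw [← smul_eq_mul, ← map_smul, ← map_add, hf]
    have h6 := congrArg (fun l : Dual ℝ W => l x) (hg ⟨_, hcon⟩)
    simp only [LinearMap.sum_apply, LinearMap.smul_apply, smul_eq_mul, LinearMap.zero_apply] at h6
    rw [← h6]
    exact sum_congr rfl fun i hi => by rw [mem_tight.1 hi]

/-- A vertex of the polyhedron `ℓ i x ≤ b i`. -/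
def IsVertex (ℓ : ι → Dual ℝ W) (b : ι → ℝ) (x : W) : Prop :=
  Feasible ℓ b x ∧ ∀ y, (∀ i ∈ tight ℓ b x, ℓ i y = 0) → y = 0

/-- The vertices `u` and `v` of the polyhedron `ℓ i x ≤ b i` are the end points of an edge. -/
def IsEdgePair (ℓ : ι → Dual ℝ W) (b : ι → ℝ) (u v : W) : Prop :=
  IsVertex ℓ b u ∧ IsVertex ℓ b v ∧ u ≠ v ∧
    ∀ y, (∀ i ∈ tight ℓ b u, i ∈ tight ℓ b v → ℓ i y = 0) → ∃ c : ℝ, y = c • (v - u)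

/-- There is an edge from `u` to `v` along which `φ` increases. -/
def EdgeUp (ℓ : ι → Dual ℝ W) (b : ι → ℝ) (φ : Dual ℝ W) (u v : W) : Prop :=
  IsEdgePair ℓ b u v ∧ φ u < φ v

section Solution

variable [FiniteDimensional ℝ W]

/-- The vectors `e` do not depend on `c`, so the solution is linear, hence continuous, in the
right-hand sides. For other `I` the value `e = 0` is a placeholder; `solution` is thus defined for
every `I`, and the closeness conditions can range over all of them. -/
theorem exists_solution (ℓ : ι → Dual ℝ W) (I : Finset ι) :
    ∃ e : ι → W, (LinearIndependent ℝ fun i : I => ℓ i) → I.card = finrank ℝ W →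
      ∀ (c : ι → ℝ) (y : W), (∀ i ∈ I, ℓ i y = c i) ↔ y = ∑ i ∈ I, c i • e i := by
  classical
  by_cases h : (LinearIndependent ℝ fun i : I => ℓ i) ∧ I.card = finrank ℝ W
  · obtain ⟨e, he, hrepr⟩ := exists_dual_vectors ℓ h.1 h.2
    refine ⟨e, fun _ _ c y => ⟨fun hy => ?_, ?_⟩⟩
    · rw [hrepr y]
      exact sum_congr rfl fun i hi => by rw [hy i hi]
    · rintro rfl i hi
      rw [map_sum, sum_eq_single_of_mem i hi]
      · simp [he i hi i hi]
      · intro j hj hji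
        simp [he j hj i hi, hji.symm]
  · exact ⟨0, fun h1 h2 => absurd ⟨h1, h2⟩ h⟩

/-- The point where the equalities `ℓ i x = c i` hold for `i ∈ I`. -/
noncomputable def solution (ℓ : ι → Dual ℝ W) (I : Finset ι) (c : ι → ℝ) : W :=
  ∑ i ∈ I, c i • (exists_solution ℓ I).choose i

theorem continuous_apply_solution (ℓ : ι → Dual ℝ W) (I : Finset ι) (f : Dual ℝ W) :
    Continuous fun c => f (solution ℓ I c) := by
  simp only [solution, map_sum, map_smul, smul_eq_mul]
  fun_prop

theorem IsSimple.eq_solution {ℓ : ι → Dual ℝ W} {c : ι → ℝ} (h : IsSimple ℓ c) (x : HVertex ℓ c) :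
    x.1 = solution ℓ (tight ℓ c x.1) c :=
  ((exists_solution ℓ (tight ℓ c x.1)).choose_spec (h.indep x.1) x.2.2 c x.1).1
    fun _ hi => mem_tight.1 hi

theorem IsSimple.tight_subset_tight_solution {ℓ : ι → Dual ℝ W} {c : ι → ℝ} (h : IsSimple ℓ c)
    (x : HVertex ℓ c) (b : ι → ℝ) :
    tight ℓ c x.1 ⊆ tight ℓ b (solution ℓ (tight ℓ c x.1) b) := fun _ hi =>
  mem_tight.2 (((exists_solution ℓ (tight ℓ c x.1)).choose_spec (h.indep x.1) x.2.2 b _).2 rfl _ hi)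

end Solution

/-- A polyhedron with ten inequalities in dimension five, with trivial recession cone: there is a
monotone path of length at most seven from any vertex to a sink. -/
theorem exists_walk_edgeUp [FiniteDimensional ℝ W] (hW : finrank ℝ W = 5)
    (hι : Fintype.card ι = 10) {ℓ : ι → Dual ℝ W} {b : ι → ℝ}
    (hrec : ∀ y, (∀ i, ℓ i y ≤ 0) → y = 0) {φ : Dual ℝ W}
    (hφ : ∀ u v, IsEdgePair ℓ b u v → φ u ≠ φ v) {v w : W} (hv : IsVertex ℓ b v)
    (hw : IsVertex ℓ b w) (hsink : ∀ u, ¬ EdgeUp ℓ b φ w u) :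
    ∃ k ≤ 7, Walk (EdgeUp ℓ b φ) k v w := by
  classical
  -- Finitely many strict inequalities between basic solutions persist for `c` near `b`. They will
  -- show that vertices lift, that projected vertices are feasible, and that the order by `φ` is
  -- compatible.
  have hlift_ev : ∀ u : W, ∀ᶠ c in 𝓝 b, ∀ I : Finset ι,
      (∑ i ∈ tight ℓ b u, ℓ i) (solution ℓ I b) < (∑ i ∈ tight ℓ b u, ℓ i) u →
      (∑ i ∈ tight ℓ b u, ℓ i) (solution ℓ I c) < (∑ i ∈ tight ℓ b u, ℓ i) u := fun u =>
    eventually_all.2 fun I => eventually_imp_distrib_left.2 fun hlt =>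
      ((continuous_apply_solution ℓ I _).tendsto b).eventually_lt_const hlt
  have hfeas_ev : ∀ᶠ c in 𝓝 b, ∀ (I : Finset ι) (k : ι), b k < ℓ k (solution ℓ I b) →
      c k < ℓ k (solution ℓ I c) :=
    eventually_all.2 fun I => eventually_all.2 fun k => eventually_imp_distrib_left.2 fun hlt =>
      ((continuous_apply k).tendsto b).eventually_lt
        ((continuous_apply_solution ℓ I _).tendsto b) hlt
  have hφ_ev : ∀ᶠ c in 𝓝 b, ∀ I J : Finset ι, φ (solution ℓ J b) < φ (solution ℓ I b) →
      φ (solution ℓ J c) < φ (solution ℓ I c) :=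
    eventually_all.2 fun I => eventually_all.2 fun J => eventually_imp_distrib_left.2 fun hlt =>
      ((continuous_apply_solution ℓ J _).tendsto b).eventually_lt
        ((continuous_apply_solution ℓ I _).tendsto b) hlt
  obtain ⟨c, hbc, hc, ⟨hvc, hwc⟩, hfeas, hφc⟩ := exists_isSimple hrec b
    (((hlift_ev v).and (hlift_ev w)).and (hfeas_ev.and hφ_ev))
  have := hc.finite
  obtain ⟨φ', hinj, hφ'⟩ := exists_injective_dual φ
    (x := fun x : HVertex ℓ c => x.1) Subtype.val_injective
  let : LinearOrder (HVertex ℓ c) := LinearOrder.lift' _ hinj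
  have hsys := hc.simpleSystem hW φ' hinj
  set π : HVertex ℓ c → W := fun x => solution ℓ (tight ℓ c x.1) b with hπ
  have htight : ∀ x, tight ℓ c x.1 ⊆ tight ℓ b (π x) := fun x =>
    hc.tight_subset_tight_solution x b
  have hπfeas : ∀ x, Feasible ℓ b (π x) := fun x k => by
    by_contra! hcon
    have h1 := hfeas _ k hcon
    rw [← hc.eq_solution x] at h1
    exact absurd (x.2.1 k) (not_le.2 h1)
  have hπvertex : ∀ x, IsVertex ℓ b (π x) := fun x => by
    refine ⟨hπfeas x, fun y hy => ?_⟩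
    obtain ⟨e, -, he⟩ := exists_dual_vectors ℓ (hc.indep x.1) x.2.2
    rw [he y]
    exact sum_eq_zero fun i hi => by rw [hy i (htight x hi), zero_smul]
  -- The sum of the functionals tight at `u` has `u` as its only maximizer on the old polyhedron. As
  -- `b ≤ c`, `u` is feasible for `c`, so a maximizing new vertex `x` has value at least that at
  -- `u`. By persistence so does `π x`, whence `π x = u`.
  have hlift : ∀ u, IsVertex ℓ b u → (∀ I : Finset ι,
      (∑ i ∈ tight ℓ b u, ℓ i) (solution ℓ I b) < (∑ i ∈ tight ℓ b u, ℓ i) u →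
      (∑ i ∈ tight ℓ b u, ℓ i) (solution ℓ I c) < (∑ i ∈ tight ℓ b u, ℓ i) u) →
      ∃ x, π x = u := by
    intro u hu huc
    have huf : Feasible ℓ c u := fun i => (hu.1 i).trans (hbc i)
    obtain ⟨x, hx⟩ := hc.exists_forall_le huf (∑ i ∈ tight ℓ b u, ℓ i)
    refine ⟨x, ?_⟩
    have h1 : (∑ i ∈ tight ℓ b u, ℓ i) u ≤ (∑ i ∈ tight ℓ b u, ℓ i) (π x) := by
      by_contra! hcon
      have h2 := huc _ hcon
      rw [← hc.eq_solution x] at h2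
      exact absurd (hx u huf) (not_le.2 h2)
    simp only [LinearMap.sum_apply] at h1
    have h3 : ∀ i ∈ tight ℓ b u, ℓ i (π x) ≤ ℓ i u := fun i hi => by
      rw [mem_tight.1 hi]
      exact hπfeas x i
    have h4 := (sum_eq_sum_iff_of_le h3).1 (le_antisymm (sum_le_sum h3) h1)
    exact sub_eq_zero.1 (hu.2 _ fun i hi => by rw [map_sub, h4 i hi, sub_self])
  have hstep : ∀ x y, Up (fun x : HVertex ℓ c => tight ℓ c x.1) x y →
      π x = π y ∨ EdgeUp ℓ b φ (π x) (π y) := by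
    rintro x y ⟨hlt, i, hi, hs⟩
    by_cases hne : π x = π y
    · exact Or.inl hne
    right
    have hedge : IsEdgePair ℓ b (π x) (π y) := by
      refine ⟨hπvertex x, hπvertex y, hne, fun z hz => ?_⟩
      obtain ⟨e, -, he⟩ := exists_dual_vectors ℓ (hc.indep x.1) x.2.2
      have hline : ∀ z, (∀ j ∈ tight ℓ c x.1, j ≠ i → ℓ j z = 0) → z = ℓ i z • e i := by
        intro z hz
        have h1 := he z
        rwa [sum_eq_single_of_mem i hi fun j hj hji => by rw [hz j hj hji, zero_smul]] at h1
      have h1 := hline z fun j hj hji => hz j (htight x hj) (htight y (hs (mem_erase.2 ⟨hji, hj⟩)))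
      have h2 := hline (π y - π x) fun j hj hji => by
        rw [map_sub, mem_tight.1 (htight x hj), mem_tight.1 (htight y (hs (mem_erase.2 ⟨hji, hj⟩))),
          sub_self]
      have h3 : ℓ i (π y - π x) ≠ 0 := fun h0 => hne (by
        rw [h0, zero_smul] at h2
        exact (sub_eq_zero.1 h2).symm)
      refine ⟨ℓ i z / ℓ i (π y - π x), ?_⟩
      rw [h2, smul_smul, ← h2, div_mul_cancel₀ _ h3]
      exact h1
    refine ⟨hedge, lt_of_le_of_ne ?_ (hφ _ _ hedge)⟩
    by_contra! hcon
    have h1 := hφc _ _ hcon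
    rw [← hc.eq_solution x, ← hc.eq_solution y] at h1
    exact absurd (hφ' x y hlt) (not_le.2 h1)
  have hwalk : ∀ k x y, Walk (Up (fun x : HVertex ℓ c => tight ℓ c x.1)) k x y →
      ∃ j ≤ k, Walk (EdgeUp ℓ b φ) j (π x) (π y) := by
    intro k
    induction k with
    | zero =>
      rintro x _ rfl
      exact ⟨0, le_rfl, rfl⟩
    | succ k ih =>
      rintro x y ⟨z, hz, hzy⟩
      obtain ⟨j, hj, hw⟩ := ih x z hz
      rcases hstep z y hzy with h | h
      · exact ⟨j, by omega, h ▸ hw⟩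
      · exact ⟨j + 1, by omega, _, hw, h⟩
  obtain ⟨v', hv'⟩ := hlift v hv hvc
  obtain ⟨w', hw'⟩ := hlift w hw hwc
  have : Nonempty (HVertex ℓ c) := ⟨v'⟩
  obtain ⟨t, ht⟩ := Finite.exists_max (id : HVertex ℓ c → HVertex ℓ c)
  -- This identifies the image of the top `t`: a walk from a lift of `w` to `t` projects to a walk
  -- from the sink `w`, which cannot move, so `π t = w`.
  have hstuck : ∀ k u, Walk (EdgeUp ℓ b φ) k w u → u = w := by
    intro k
    induction k with
    | zero => rintro u rfl; rfl
    | succ k ih =>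
      rintro u ⟨y, hy, hr⟩
      rw [ih y hy] at hr
      exact absurd hr (hsink u)
  obtain ⟨k, -, hk⟩ := hsys.exists_walk_five hι ht w'
  obtain ⟨j, -, hj⟩ := hwalk k w' t hk
  have htw : π t = w := hstuck j _ (hw' ▸ hj)
  obtain ⟨k, hk7, hk⟩ := hsys.exists_walk_five hι ht v'
  obtain ⟨j, hjk, hj⟩ := hwalk k v' t hk
  rw [hv', htw] at hj
  exact ⟨j, hjk.trans hk7, hj⟩

end MonotoneDiameter

/-! ### A polytope is cut out of its affine span by its facets. -/

namespace MonotoneDiameter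

open Finset Module Filter Topology

/-- A half-space that contains a finite set but not `z` can be rotated until its boundary is
spanned by points of the set. -/
theorem exists_ker_le_span {X : Type*} [AddCommGroup X] [Module ℝ X] [FiniteDimensional ℝ X]
    (S : Finset X) (hS : ∀ f : Dual ℝ X, (∀ s ∈ S, f s = 0) → f = 0) {z : X} {f₀ : Dual ℝ X}
    (h₀ : ∀ s ∈ S, f₀ s ≤ 0) (hz : 0 < f₀ z) :
    ∃ f : Dual ℝ X, (∀ s ∈ S, f s ≤ 0) ∧ 0 < f z ∧
      LinearMap.ker f ≤ Submodule.span ℝ {s | s ∈ S ∧ f s = 0} := by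
  -- Choose `f` with the span of its zeros in `S` as large as possible. If its kernel were larger,
  -- adding a suitable multiple of a functional vanishing on this span and at `z` would gain a zero
  -- in `S`, with the value at `z` unchanged.
  obtain ⟨m, ⟨f, hf, hfz, hm⟩, hmax⟩ := Set.exists_max_image
    {m : ℕ | ∃ f : Dual ℝ X, (∀ s ∈ S, f s ≤ 0) ∧ 0 < f z ∧
      finrank ℝ (Submodule.span ℝ {s | s ∈ S ∧ f s = 0}) = m} id
    ((Set.finite_Iic (finrank ℝ X)).subset (by
      rintro m ⟨f, -, -, rfl⟩
      exact Submodule.finrank_le _)) ⟨_, f₀, h₀, hz, rfl⟩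
  refine ⟨f, hf, hfz, fun k hk => ?_⟩
  rw [LinearMap.mem_ker] at hk
  by_contra hkT
  set T := Submodule.span ℝ {s | s ∈ S ∧ f s = 0} with hT
  obtain ⟨g, hgk, hgT⟩ := Submodule.exists_dual_map_eq_bot_of_notMem hkT inferInstance
  have hgT' : ∀ x ∈ T, g x = 0 := fun x hx => by
    have : g x ∈ T.map g := Submodule.mem_map_of_mem hx
    rwa [hgT, Submodule.mem_bot] at this
  -- a functional that vanishes on `T` and at `z`, positive at some point of `S`
  obtain ⟨g', hg'T, hg'z, s₀, hs₀, hg's₀⟩ : ∃ g' : Dual ℝ X, (∀ x ∈ T, g' x = 0) ∧ g' z = 0 ∧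
      ∃ s ∈ S, 0 < g' s := by
    set q := g - (g z / f z) • f with hq
    have hqT : ∀ x ∈ T, q x = 0 := fun x hx => by
      have hfx : f x = 0 := by
        have : T ≤ LinearMap.ker f := Submodule.span_le.2 fun s hs => hs.2
        exact this hx
      simp [hq, hgT' x hx, hfx]
    have hqz : q z = 0 := by
      simp [hq, div_mul_cancel₀ _ hfz.ne']
    have hqk : q k ≠ 0 := by simpa [hq, hk] using hgk
    obtain ⟨s, hs, hqs⟩ : ∃ s ∈ S, q s ≠ 0 := by
      by_contra! hcon
      exact hqk (by rw [hS q hcon, LinearMap.zero_apply])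
    rcases lt_or_gt_of_ne hqs with h | h
    · exact ⟨-q, fun x hx => by simp [hqT x hx], by simp [hqz], s, hs, by simpa using h⟩
    · exact ⟨q, hqT, hqz, s, hs, h⟩
  obtain ⟨s₁, hs₁, hmin⟩ := exists_min_image (S.filter fun s => 0 < g' s)
    (fun s => -f s / g' s) ⟨s₀, by simp [hs₀, hg's₀]⟩
  rw [mem_filter] at hs₁
  set t := -f s₁ / g' s₁ with ht
  have ht0 : 0 ≤ t := div_nonneg (neg_nonneg.2 (hf s₁ hs₁.1)) hs₁.2.le
  have hs₁0 : (f + t • g') s₁ = 0 := by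
    simp only [LinearMap.add_apply, LinearMap.smul_apply, smul_eq_mul, ht]
    rw [div_mul_cancel₀ _ hs₁.2.ne']
    ring
  have hle : T < Submodule.span ℝ {s | s ∈ S ∧ (f + t • g') s = 0} := by
    refine lt_of_le_of_ne (Submodule.span_mono ?_) fun heq => ?_
    · rintro s ⟨hs, hfs⟩
      refine ⟨hs, ?_⟩
      simp [hfs, hg'T s (Submodule.subset_span ⟨hs, hfs⟩)]
    · have : s₁ ∈ T := by
        rw [heq]
        exact Submodule.subset_span ⟨hs₁.1, hs₁0⟩
      exact hs₁.2.ne' (hg'T s₁ this)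
  have h1 := hmax _ ⟨f + t • g', fun s hs => ?_, by simp [hg'z, hfz], rfl⟩
  · have h2 := Submodule.finrank_lt_finrank_of_lt hle
    simp only [id] at h1
    omega
  · simp only [LinearMap.add_apply, LinearMap.smul_apply, smul_eq_mul]
    rcases le_or_gt (g' s) 0 with h | h
    · have := hf s hs
      nlinarith
    · have := hmin s (mem_filter.2 ⟨hs, h⟩)
      rw [le_div_iff₀ h] at this
      linarith

section Polytope

variable {E : Type*} [NormedAddCommGroup E] [NormedSpace ℝ E]

/-- The functional of `(x, r)` on the homogenization of the span of `P`. -/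
noncomputable def homog (W : Submodule ℝ E) (l : E →ₗ[ℝ] ℝ) (c : ℝ) : Dual ℝ (W × ℝ) :=
  (l.comp W.subtype).coprod (c • LinearMap.id)

theorem homog_apply (W : Submodule ℝ E) (l : E →ₗ[ℝ] ℝ) (c : ℝ) (x : W × ℝ) :
    homog W l c x = l x.1 + c * x.2 := by
  simp [homog]

theorem exists_eq_homog [FiniteDimensional ℝ E] (W : Submodule ℝ E) (f : Dual ℝ (W × ℝ)) :
    ∃ (l : StrongDual ℝ E) (c : ℝ), f = homog W l c := by
  obtain ⟨l, hl⟩ := LinearMap.exists_extend (f.comp (LinearMap.inl ℝ W ℝ))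
  refine ⟨LinearMap.toContinuousLinearMap l, f (0, 1), LinearMap.ext fun x => ?_⟩
  rw [homog_apply]
  have h1 : l x.1 = f (x.1, 0) := congrArg (fun g : W →ₗ[ℝ] ℝ => g x.1) hl
  have h2 : x = (x.1, (0 : ℝ)) + x.2 • ((0 : W), (1 : ℝ)) := by ext <;> simp
  conv_lhs => rw [h2, map_add, map_smul]
  simp [h1, mul_comm]

/-- A point of the affine span of a polytope outside of it violates the inequality of a facet. -/
theorem exists_facet_separating [FiniteDimensional ℝ E] {P : Set E} (hP : IsPolytope P)
    (hd : 0 < dim P) {p₀ : E} (hp₀ : p₀ ∈ P) {z : E} (hzW : z ∈ vectorSpan ℝ P)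
    (hz : p₀ + z ∉ P) :
    ∃ F, IsFacet P F ∧ ∀ l : StrongDual ℝ E, F = {x ∈ P | ∀ y ∈ P, l y ≤ l x} →
      ∀ x ∈ F, l x < l (p₀ + z) := by
  classical
  obtain ⟨S, rfl⟩ := hP
  set P := convexHull ℝ (S : Set E) with hPdef
  set W := vectorSpan ℝ P with hW
  have hmemW : ∀ p ∈ P, p - p₀ ∈ W := fun p hp => vsub_mem_vectorSpan ℝ hp hp₀
  have hPS : ∀ (l : E →ₗ[ℝ] ℝ) (m : ℝ), (∀ s ∈ S, l s ≤ m) → ∀ p ∈ P, l p ≤ m := by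
    intro l m h p hp
    exact convexHull_min (t := {x | l x ≤ m}) h (convex_halfSpace_le l.isLinear m) hp
  have hSP : ∀ s ∈ S, s ∈ P := fun s hs => subset_convexHull ℝ _ hs
  -- Placing the points at height 1 turns affine functions on the affine span into linear
  -- functionals on `W × ℝ`.
  let pt : S → W × ℝ := fun s => (⟨s - p₀, hmemW s (hSP s s.2)⟩, 1)
  have hspan : ∀ f : Dual ℝ (W × ℝ), (∀ x ∈ univ.image pt, f x = 0) → f = 0 := by
    intro f hf
    obtain ⟨l, c, rfl⟩ := exists_eq_homog W f
    have h1 : ∀ s ∈ S, l s = l p₀ - c := by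
      intro s hs
      have := hf (pt ⟨s, hs⟩) (mem_image_of_mem _ (mem_univ _))
      rw [homog_apply] at this
      simp only [pt, map_sub, ContinuousLinearMap.coe_coe] at this
      linarith
    have h2 : ∀ p ∈ P, l p = l p₀ - c := fun p hp => le_antisymm
      (hPS l _ (fun s hs => (h1 s hs).le) p hp)
      (by
        have := hPS (-l) (-(l p₀ - c)) (fun s hs => by simp [h1 s hs]) p hp
        simp only [LinearMap.neg_apply, ContinuousLinearMap.coe_coe] at this
        linarith)
    have hc : c = 0 := by linarith [h2 p₀ hp₀]
    have h3 : ∀ x ∈ W, l x = 0 := by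
      intro x hx
      have : W ≤ LinearMap.ker (l : E →ₗ[ℝ] ℝ) := by
        rw [hW, vectorSpan, Submodule.span_le]
        rintro _ ⟨p, hp, q, hq, rfl⟩
        simp [h2 p hp, h2 q hq]
      exact this hx
    refine LinearMap.ext fun x => ?_
    rw [homog_apply, hc]
    simp [h3 x.1 x.1.2]
  -- a separating functional, rotated
  obtain ⟨l₀, u, hlu, hul⟩ := geometric_hahn_banach_closed_point (convex_convexHull ℝ _)
    (S.finite_toSet.isClosed_convexHull ℝ) hz
  obtain ⟨f, hfS, hfz, hker⟩ := exists_ker_le_span (univ.image pt) hspan (z := (⟨z, hzW⟩, 1))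
    (f₀ := homog W l₀ (l₀ p₀ - u)) (by
      intro x hx
      obtain ⟨s, -, rfl⟩ := mem_image.1 hx
      rw [homog_apply]
      have := hlu s (hSP s s.2)
      simp only [pt, map_sub, ContinuousLinearMap.coe_coe]
      linarith) (by
      rw [homog_apply]
      rw [map_add] at hul
      simp only [ContinuousLinearMap.coe_coe]
      linarith)
  obtain ⟨g, c, rfl⟩ := exists_eq_homog W f
  set m := g p₀ - c with hm
  have hgS : ∀ s ∈ S, g s ≤ m := by
    intro s hs
    have := hfS (pt ⟨s, hs⟩) (mem_image_of_mem _ (mem_univ _))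
    rw [homog_apply] at this
    simp only [pt, map_sub, ContinuousLinearMap.coe_coe] at this
    linarith
  have hgP : ∀ p ∈ P, g p ≤ m := hPS g m hgS
  have hgz : m < g (p₀ + z) := by
    rw [homog_apply] at hfz
    simp only [ContinuousLinearMap.coe_coe] at hfz
    rw [map_add]
    linarith
  set F := {p ∈ P | g p = m} with hF
  have htight : ∀ s : S, homog W (g : E →ₗ[ℝ] ℝ) c (pt s) = 0 → (s : E) ∈ F := by
    intro s hs
    rw [homog_apply] at hs
    simp only [pt, map_sub, ContinuousLinearMap.coe_coe] at hs
    exact ⟨hSP s s.2, by linarith⟩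
  -- the restriction of `g` to the span
  set gW : W →ₗ[ℝ] ℝ := (g : E →ₗ[ℝ] ℝ).comp W.subtype with hgW
  have hgW0 : gW ≠ 0 := by
    intro h0
    have h1 : ∀ x ∈ W, g x = 0 := fun x hx =>
      congrArg (fun l : W →ₗ[ℝ] ℝ => l ⟨x, hx⟩) h0
    have h2 := hgP p₀ hp₀
    rw [map_add, h1 z hzW] at hgz
    linarith
  have hkerW : finrank ℝ (LinearMap.ker gW) + 1 = dim P := by
    have h1 := LinearMap.finrank_range_add_finrank_ker gW
    rw [LinearMap.range_eq_top.2 (LinearMap.surjective hgW0), finrank_top, finrank_self] at h1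
    rw [dim, ← h1, add_comm]
  have hFne : F.Nonempty := by
    have hlt : finrank ℝ ℝ < finrank ℝ (W × ℝ) := by
      rw [finrank_prod, finrank_self]
      have : 0 < finrank ℝ W := hd
      omega
    obtain ⟨x, hx, hx0⟩ := Submodule.exists_mem_ne_zero_of_ne_bot
      (LinearMap.ker_ne_bot_of_finrank_lt (f := homog W (g : E →ₗ[ℝ] ℝ) c) hlt)
    have h1 := hker hx
    by_contra hcon
    rw [Set.not_nonempty_iff_eq_empty] at hcon
    have h2 : {s | s ∈ univ.image pt ∧ homog W (g : E →ₗ[ℝ] ℝ) c s = 0} = ∅ := by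
      refine Set.eq_empty_of_forall_notMem fun y hy => ?_
      obtain ⟨s, -, rfl⟩ := mem_image.1 hy.1
      have := htight s hy.2
      rw [hcon] at this
      exact this
    rw [h2, Submodule.span_empty, Submodule.mem_bot] at h1
    exact hx0 h1
  obtain ⟨q, hqP, hqm⟩ := hFne
  have hFexp : F = {x ∈ P | ∀ y ∈ P, g y ≤ g x} := by
    ext x
    constructor
    · rintro ⟨hx, hxm⟩
      exact ⟨hx, fun y hy => hxm ▸ hgP y hy⟩
    · rintro ⟨hx, hxm⟩
      exact ⟨hx, le_antisymm (hgP x hx) (hqm ▸ hxm q hqP)⟩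
  have hvs : vectorSpan ℝ F = (LinearMap.ker gW).map W.subtype := by
    refine le_antisymm ?_ ?_
    · rw [vectorSpan, Submodule.span_le]
      rintro _ ⟨a, ha, b, hb, rfl⟩
      refine ⟨⟨a - b, vsub_mem_vectorSpan ℝ ha.1 hb.1⟩, ?_, rfl⟩
      simp [hgW, ha.2, hb.2]
    · rintro _ ⟨x, hx, rfl⟩
      have h1 : ((x, 0) : W × ℝ) ∈ LinearMap.ker (homog W (g : E →ₗ[ℝ] ℝ) c) := by
        rw [LinearMap.mem_ker, homog_apply]
        simpa [hgW] using hx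
      -- The linear map `y ↦ y.1 - y.2 • (q - p₀)` sends the lift of `s` to `s - q`, and fixes
      -- vectors of height 0.
      have h2 : ∀ y : W × ℝ, y ∈ Submodule.span ℝ
          {s | s ∈ univ.image pt ∧ homog W (g : E →ₗ[ℝ] ℝ) c s = 0} →
          (y.1 : E) - y.2 • (q - p₀) ∈ vectorSpan ℝ F := by
        intro y hy
        induction hy using Submodule.span_induction with
        | mem y hy =>
          obtain ⟨s, -, rfl⟩ := mem_image.1 hy.1
          have h3 : (s : E) - q ∈ vectorSpan ℝ F :=
            vsub_mem_vectorSpan ℝ (htight s hy.2) ⟨hqP, hqm⟩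
          convert h3 using 1
          simp [pt]
        | zero => simp
        | add a b _ _ ha hb =>
          convert Submodule.add_mem _ ha hb using 1
          simp only [Prod.fst_add, Prod.snd_add, Submodule.coe_add, add_smul]
          abel
        | smul r a _ ha =>
          convert Submodule.smul_mem _ r ha using 1
          simp [smul_sub, mul_smul]
      simpa using h2 _ (hker h1)
  have hdimF : dim F + 1 = dim P := by
    rw [← hkerW, dim, hvs, Submodule.finrank_map_subtype_eq]
  refine ⟨F, ⟨⟨⟨q, hqP, hqm⟩, fun _ => ⟨g, hFexp⟩⟩, hdimF⟩, fun l hl x hx => ?_⟩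
  -- `l` is a positive multiple of `g` up to a constant
  have hlF : ∀ y ∈ F, l y = l x := by
    intro y hy
    have hx' := hx
    rw [hl] at hy hx'
    exact le_antisymm (hx'.2 y hy.1) (hy.2 x hx'.1)
  set h := homog W (l : E →ₗ[ℝ] ℝ) (l p₀ - l x) with hh
  have hhP : ∀ p (hp : p ∈ P), h (⟨p - p₀, hmemW p hp⟩, 1) = l p - l x := by
    intro p hp
    rw [hh, homog_apply]
    simp
  have hker' : ∀ y, homog W (g : E →ₗ[ℝ] ℝ) c y = 0 → h y = 0 := by
    intro y hy
    have h1 : Submodule.span ℝ {s | s ∈ univ.image pt ∧ homog W (g : E →ₗ[ℝ] ℝ) c s = 0} ≤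
        LinearMap.ker h := by
      rw [Submodule.span_le]
      rintro y ⟨hy1, hy2⟩
      obtain ⟨s, -, rfl⟩ := mem_image.1 hy1
      rw [SetLike.mem_coe, LinearMap.mem_ker]
      refine (hhP s (hSP s s.2)).trans ?_
      rw [hlF s (htight s hy2), sub_self]
    exact h1 (hker hy)
  obtain ⟨p, hpP, hpF⟩ : ∃ p ∈ P, p ∉ F := by
    by_contra! hcon
    have : F = P := Set.Subset.antisymm (fun y hy => hy.1) hcon
    rw [this] at hdimF
    omega
  have hgp : g p < m := lt_of_le_of_ne (hgP p hpP) fun h' => hpF ⟨hpP, h'⟩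
  have hlp : l p < l x := by
    have hx' := hx
    rw [hl] at hx'
    refine lt_of_le_of_ne (hx'.2 p hpP) fun h' => hpF ?_
    rw [hl]
    exact ⟨hpP, fun y hy => h' ▸ hx'.2 y hy⟩
  set Z : W × ℝ := (⟨z, hzW⟩, 1) with hZ
  set Y : W × ℝ := (⟨p - p₀, hmemW p hpP⟩, 1) with hY
  have hgY : homog W (g : E →ₗ[ℝ] ℝ) c Y = g p - m := by
    rw [homog_apply]
    simp [hY, hm]
    ring
  have hgZ : homog W (g : E →ₗ[ℝ] ℝ) c Z = g (p₀ + z) - m := by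
    rw [homog_apply]
    simp [hZ, hm]
  have hhZ : h Z = l (p₀ + z) - l x := by
    rw [hh, homog_apply]
    simp [hZ]
    ring
  -- This combination of the outer point and a point of `P` off `F` lies in the kernel of `g`'s
  -- lift, hence of `h`. Since `h` is negative at `Y` and both coefficients are positive, it is
  -- positive at `Z`.
  have hcomb := hker' ((m - g p) • Z + (g (p₀ + z) - m) • Y) (by
    rw [map_add, map_smul, map_smul, hgY, hgZ, smul_eq_mul, smul_eq_mul]
    ring)
  rw [map_add, map_smul, map_smul, hhZ, hhP p hpP, smul_eq_mul, smul_eq_mul] at hcomb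
  by_contra! hcon
  nlinarith [mul_pos (sub_pos.2 hgz) (sub_pos.2 hlp), mul_nonneg (sub_nonneg.2 hcon)
    (sub_pos.2 hgp).le]

end Polytope

end MonotoneDiameter

/-! ### From the inequalities back to faces and monotone paths of the polytope. -/

namespace MonotoneDiameter

open Finset Module Filter Topology

section Graph

variable {E : Type*} [AddCommGroup E] [Module ℝ E] [TopologicalSpace E]

theorem HasMonotonePath.snoc {P : Set E} {φ : E →ₗ[ℝ] ℝ} {u v w : E} {k : ℕ}
    (h : HasMonotonePath P φ u v k) (hvw : Arc P φ v w) : HasMonotonePath P φ u w (k + 1) := by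
  obtain ⟨p, hp0, hpk, hp⟩ := h
  refine ⟨Fin.snoc p w, ?_, by simp, fun i => ?_⟩
  · rw [← hp0, ← Fin.castSucc_zero, Fin.snoc_castSucc]
  · refine Fin.lastCases ?_ (fun i => ?_) i
    · rw [Fin.succ_last, Fin.snoc_last, Fin.snoc_castSucc, hpk]
      exact hvw
    · rw [Fin.snoc_castSucc, Fin.succ_castSucc, Fin.snoc_castSucc]
      exact hp i

theorem hasMonotonePath_of_walk {P : Set E} {φ : E →ₗ[ℝ] ℝ} {u v : E} {k : ℕ}
    (h : Walk (Arc P φ) k u v) : HasMonotonePath P φ u v k := by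
  induction k generalizing v with
  | zero => exact ⟨fun _ => u, rfl, h, fun i => i.elim0⟩
  | succ k ih =>
    obtain ⟨y, hy, hr⟩ := h
    exact (ih hy).snoc hr

end Graph

variable {E : Type*} [NormedAddCommGroup E] [NormedSpace ℝ E]

/-- In a polytope of dimension five with ten facets there is a monotone path of length at most
seven from any vertex to a sink. -/
theorem exists_walk_arc [FiniteDimensional ℝ E] {P : Set E} (hP : IsPolytope P) (hd : dim P = 5)
    (hn : {F | IsFacet P F}.encard = 10) {φ : E →ₗ[ℝ] ℝ} (hφ : Admissible P φ) {v w : E}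
    (hv : v ∈ P.extremePoints ℝ) (hw : IsSink P φ w) : ∃ k ≤ 7, Walk (Arc P φ) k v w := by
  classical
  have hfin : {F | IsFacet P F}.Finite := Set.finite_of_encard_eq_coe (k := 10) (by simpa using hn)
  let ι := {F | IsFacet P F}
  have : Fintype ι := hfin.fintype
  have hι : Fintype.card ι = 10 := by
    have h1 : ((Fintype.card ι : ℕ) : ℕ∞) = 10 := by
      rw [← hn, Set.encard_eq_coe_toFinset_card, Set.toFinset_card]
    exact_mod_cast h1
  have hp₀ : v ∈ P := hv.1
  set W := vectorSpan ℝ P with hW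
  have hmemW : ∀ p ∈ P, p - v ∈ W := fun p hp => vsub_mem_vectorSpan ℝ hp hp₀
  have hfacet : ∀ F : ι, ∃ l : StrongDual ℝ E, (F : Set E) = {x ∈ P | ∀ y ∈ P, l y ≤ l x} :=
    fun F => F.2.1.2 F.2.1.1
  have hpoint : ∀ F : ι, ∃ x, x ∈ (F : Set E) := fun F => F.2.1.1
  choose l hl using hfacet
  choose x hx using hpoint
  set ℓ : ι → Dual ℝ W := fun F => (l F : E →ₗ[ℝ] ℝ).comp W.subtype with hℓ
  set b : ι → ℝ := fun F => l F (x F) - l F v with hb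
  have hfeas : ∀ y : W, Feasible ℓ b y ↔ v + y ∈ P := by
    intro y
    constructor
    · intro hy
      by_contra hcon
      obtain ⟨F, hF, hsep⟩ := exists_facet_separating hP (by omega) hp₀ y.2 hcon
      have h1 := hsep (l ⟨F, hF⟩) (hl ⟨F, hF⟩) _ (hx ⟨F, hF⟩)
      have h2 := hy ⟨F, hF⟩
      simp only [hℓ, hb, LinearMap.comp_apply, Submodule.subtype_apply,
        ContinuousLinearMap.coe_coe] at h2
      rw [map_add] at h1
      linarith
    · intro hy F
      have h1 := hx F
      rw [hl F] at h1
      have h2 := h1.2 _ hy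
      simp only [hℓ, hb, LinearMap.comp_apply, Submodule.subtype_apply,
        ContinuousLinearMap.coe_coe]
      rw [map_add] at h2
      linarith
  have hcpt : IsCompact P := by
    obtain ⟨S, rfl⟩ := hP
    exact S.finite_toSet.isCompact_convexHull ℝ
  have hrec : ∀ y, (∀ i, ℓ i y ≤ 0) → y = 0 := by
    intro y hy
    by_contra hy0
    have h1 : ∀ s : ℝ, 0 ≤ s → v + s • (y : E) ∈ P := by
      intro s hs
      refine (hfeas (s • y)).1 fun i => ?_
      have h2 : ℓ i 0 ≤ b i := (hfeas 0).2 (by simpa using hp₀) i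
      rw [map_zero] at h2
      rw [map_smul, smul_eq_mul]
      nlinarith [hy i]
    obtain ⟨R, hR⟩ := hcpt.isBounded.exists_norm_le
    have hpos : 0 < ‖(y : E)‖ := norm_pos_iff.2 fun h => hy0 (Subtype.ext h)
    have hR0 : 0 ≤ R := (norm_nonneg _).trans (hR v hp₀)
    have h3 := hR _ (h1 ((R + ‖v‖ + 1) / ‖(y : E)‖) (by positivity))
    have h4 : ‖((R + ‖v‖ + 1) / ‖(y : E)‖) • (y : E)‖ = R + ‖v‖ + 1 := by
      rw [norm_smul, Real.norm_of_nonneg (by positivity), div_mul_cancel₀ _ hpos.ne']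
    have h5 := norm_sub_le (v + ((R + ‖v‖ + 1) / ‖(y : E)‖) • (y : E)) v
    rw [add_sub_cancel_left, h4] at h5
    linarith
  have hvertex : ∀ u (hu : u ∈ P.extremePoints ℝ), IsVertex ℓ b ⟨u - v, hmemW u hu.1⟩ := by
    intro u hu
    set u' : W := ⟨u - v, hmemW u hu.1⟩ with hu'
    have hu'f : Feasible ℓ b u' := (hfeas u').2 (by simpa [hu'] using hu.1)
    refine ⟨hu'f, fun y hy => ?_⟩
    -- A direction killed by all tight functionals can be followed a little both ways, which at an
    -- extreme point forces it to be zero.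
    have hev : ∀ᶠ s in 𝓝[>] (0 : ℝ), ∀ i, ℓ i (u' + s • y) ≤ b i ∧ ℓ i (u' - s • y) ≤ b i := by
      refine eventually_all.2 fun i => ?_
      by_cases hi : i ∈ tight ℓ b u'
      · refine Eventually.of_forall fun s => ?_
        rw [map_add, map_sub, map_smul, hy i hi, smul_zero, add_zero, sub_zero]
        exact ⟨hu'f i, hu'f i⟩
      · have hlt : 0 < b i - ℓ i u' :=
          sub_pos.2 (lt_of_le_of_ne (hu'f i) fun h => hi (mem_tight.2 h))
        filter_upwards [eventually_add_mul_pos (ℓ i y) hlt,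
          eventually_add_mul_pos (-ℓ i y) hlt] with s h1 h2
        rw [map_add, map_sub, map_smul, smul_eq_mul]
        constructor <;> linarith
    obtain ⟨s, hs, hs0⟩ := (hev.and self_mem_nhdsWithin).exists
    have h1 : u + s • (y : E) ∈ P := by
      have := (hfeas (u' + s • y)).1 fun i => (hs i).1
      convert this using 1
      simp only [hu', Submodule.coe_add, Submodule.coe_smul]
      abel
    have h2 : u - s • (y : E) ∈ P := by
      have := (hfeas (u' - s • y)).1 fun i => (hs i).2
      convert this using 1
      simp only [hu', Submodule.coe_sub, Submodule.coe_smul]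
      abel
    have h3 : u ∈ openSegment ℝ (u + s • (y : E)) (u - s • (y : E)) := by
      refine ⟨1 / 2, 1 / 2, by norm_num, by norm_num, by norm_num, ?_⟩
      rw [← smul_add, add_add_sub_cancel, ← two_smul ℝ u, smul_smul]
      norm_num
    have h4 := hu.2 h1 h2 h3
    rw [add_eq_left, smul_eq_zero] at h4
    exact Subtype.ext (h4.resolve_left (ne_of_gt hs0))
  have hedge : ∀ a c, IsEdgePair ℓ b a c → IsEdge P (segment ℝ (v + a) (v + c)) := by
    rintro a c ⟨ha, hc, hne, hline⟩
    have hbeyond : ∀ a c : W, IsVertex ℓ b a → IsVertex ℓ b c → a ≠ c → ∀ s : ℝ,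
        Feasible ℓ b (a + s • (c - a)) → 0 ≤ s := by
      intro a c ha hc hne s hs
      by_contra! hneg
      refine hne (sub_eq_zero.1 (ha.2 (c - a) fun i hi => ?_)).symm
      have h1 := mem_tight.1 hi
      have h2 := hc.1 i
      have h3 := hs i
      rw [map_add, map_smul, smul_eq_mul, h1] at h3
      have h4 : ℓ i (c - a) ≤ 0 := by rw [map_sub]; linarith
      nlinarith
    -- The sum of the functionals tight at both ends exposes the edge: at a maximizer all of them
    -- are tight, so it lies on the line through `a` and `c`, and `hbeyond` confines it to the
    -- segment.
    obtain ⟨g, hg⟩ := LinearMap.exists_extend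
      (∑ i ∈ tight ℓ b a with i ∈ tight ℓ b c, ℓ i : Dual ℝ W)
    have hgW : ∀ y : W, g y = ∑ i ∈ tight ℓ b a with i ∈ tight ℓ b c, ℓ i y := fun y => by
      have := congrArg (fun f : W →ₗ[ℝ] ℝ => f y) hg
      simpa [LinearMap.sum_apply] using this
    have hgP : ∀ y : W, Feasible ℓ b y → (∀ z ∈ P, g z ≤ g (v + y)) →
        y ∈ segment ℝ a c := by
      intro y hy hmax
      have h1 := hmax (v + a) ((hfeas a).1 ha.1)
      rw [map_add, map_add, hgW, hgW, add_le_add_iff_left] at h1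
      have h2 : ∀ i ∈ (tight ℓ b a).filter (· ∈ tight ℓ b c), ℓ i y ≤ ℓ i a := fun i hi => by
        rw [mem_tight.1 (mem_filter.1 hi).1]
        exact hy i
      have h3 := (sum_eq_sum_iff_of_le h2).1 (le_antisymm (sum_le_sum h2) h1)
      obtain ⟨s, hs⟩ := hline (y - a) fun i hi hi' => by
        rw [map_sub, h3 i (mem_filter.2 ⟨hi, hi'⟩), sub_self]
      have hys : y = a + s • (c - a) := by rw [← hs]; abel
      have hs0 := hbeyond a c ha hc hne s (hys ▸ hy)
      have hs1 := hbeyond c a hc ha hne.symm (1 - s) (by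
        convert hy using 1
        rw [hys]
        module)
      exact ⟨1 - s, s, hs1, hs0, by ring, by rw [hys]; module⟩
    have hmaxval : ∀ z ∈ P, ∀ y ∈ segment ℝ a c, g z ≤ g (v + y) := by
      rintro z hz y ⟨r, s, hr, hs, hrs, rfl⟩
      have h1 : z = v + (⟨z - v, hmemW z hz⟩ : W) := by simp
      have h2 : Feasible ℓ b ⟨z - v, hmemW z hz⟩ := (hfeas _).2 (by simpa using hz)
      rw [h1, map_add, map_add, hgW, hgW, add_le_add_iff_left]
      refine sum_le_sum fun i hi => ?_
      rw [mem_filter] at hi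
      rw [map_add, map_smul, map_smul, mem_tight.1 hi.1, mem_tight.1 hi.2, ← add_smul, hrs,
        one_smul]
      exact h2 i
    have hconv : Convex ℝ P := by
      obtain ⟨S, rfl⟩ := hP
      exact convex_convexHull ℝ _
    have hseg : segment ℝ (v + (a : E)) (v + c) =
        {x ∈ P | ∀ y ∈ P, LinearMap.toContinuousLinearMap g y ≤
          LinearMap.toContinuousLinearMap g x} := by
      ext z
      constructor
      · intro hz
        refine ⟨hconv.segment_subset ((hfeas a).1 ha.1) ((hfeas c).1 hc.1) hz, fun y hy => ?_⟩
        obtain ⟨r, s, hr, hs, hrs, rfl⟩ := hz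
        have h1 := hmaxval y hy (r • a + s • c) ⟨r, s, hr, hs, hrs, rfl⟩
        have h2 : r • (v + (a : E)) + s • (v + (c : E)) =
            (r + s) • v + (r • (a : E) + s • (c : E)) := by
          module
        rw [h2, hrs, one_smul]
        exact h1
      · rintro ⟨hz, hmax⟩
        have h1 : Feasible ℓ b ⟨z - v, hmemW z hz⟩ := (hfeas _).2 (by simpa using hz)
        obtain ⟨r, s, hr, hs, hrs, heq⟩ := hgP _ h1 (fun y hy => by simpa using hmax y hy)
        refine ⟨r, s, hr, hs, hrs, ?_⟩
        have h3 : r • (a : E) + s • (c : E) = z - v := congrArg Subtype.val heq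
        have h2 : v = (r + s) • v := by rw [hrs, one_smul]
        have h4 : z = (r + s) • v + (r • (a : E) + s • (c : E)) := by
          rw [h3, ← h2]; abel
        rw [h4]
        module
    refine ⟨⟨⟨_, left_mem_segment ℝ _ _⟩, fun _ => ⟨_, hseg⟩⟩, ?_⟩
    rw [dim, vectorSpan_segment]
    refine finrank_span_singleton ?_
    simp only [vsub_eq_sub, add_sub_add_left_eq_sub]
    intro h0
    rw [sub_eq_zero] at h0
    exact hne (Subtype.ext h0.symm)
  set φW : Dual ℝ W := φ.comp W.subtype with hφW
  have hφ' : ∀ a c, IsEdgePair ℓ b a c → φW a ≠ φW c := by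
    intro a c hac heq
    obtain ⟨p, hp, q, hq, hpq⟩ := hφ _ (hedge a c hac)
    have h1 : ∀ p ∈ segment ℝ (v + (a : E)) (v + c), φ p = φ (v + a) := by
      rintro p ⟨r, s, -, -, hrs, rfl⟩
      have h2 : φ a = φ c := heq
      rw [map_add, map_smul, map_smul, map_add, map_add, h2, ← add_smul, hrs, one_smul]
    exact hpq ((h1 p hp).trans (h1 q hq).symm)
  have harc : ∀ a c, EdgeUp ℓ b φW a c → Arc P φ (v + a) (v + c) := by
    rintro a c ⟨hac, hlt⟩
    refine ⟨hedge a c hac, ?_⟩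
    rw [map_add, map_add]
    exact add_lt_add_right hlt _
  obtain ⟨k, hk, hwalk⟩ := exists_walk_edgeUp (W := W) hd hι hrec hφ' (hvertex v hv)
    (hvertex w hw.1) (fun u hu => hw.2 _ (by simpa using harc _ _ hu))
  refine ⟨k, hk, ?_⟩
  have hmap : ∀ k a c, Walk (EdgeUp ℓ b φW) k a c → Walk (Arc P φ) k (v + a) (v + c) := by
    intro k a
    induction k with
    | zero => rintro _ rfl; rfl
    | succ k ih => rintro c ⟨y, hy, hr⟩; exact ⟨_, ih y hy, harc _ _ hr⟩
  simpa using hmap _ _ _ hwalk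

end MonotoneDiameter

theorem mainTheorem7 : MonotoneDiameter.monotoneDiameter 5 10 ≤ 7 := by
  refine sSup_le ?_
  rintro k ⟨N, P, φ, v, w, hP, hd, hn, hφ, hv, hw, rfl⟩
  obtain ⟨j, hj, hwalk⟩ := MonotoneDiameter.exists_walk_arc hP hd (by simpa using hn) hφ hv hw
  have hle : MonotoneDiameter.monotoneDist P φ v w ≤ j :=
    sInf_le ⟨j, rfl, MonotoneDiameter.hasMonotonePath_of_walk hwalk⟩
  refine hle.trans ?_
  exact_mod_cast hj
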